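/- Let $\omega\in\mathbb C\setminus\{0\}$. Let $U_q(h)$ be the unital associative $\mathbb C$-algebra generated by $A,A^\dagger,N,H$ and the exponentials $e^{\pm\omega H/4}$ (mutually inverse elements; powers of $e^{\omega H/4}$ are written $e^{m\omega H/4}$, $m\in\mathbb Z$) with relations $$[A,A^\dagger]=[H]:=\tfrac1\omega\big(e^{\omega H/2}-e^{-\omega H/2}\big),\qquad [N,A]=-A,\qquad [N,A^\dagger]=A^\dagger,\qquad H,\ e^{\pm\omega H/4}\ \text{central}.$$ Its Hopf algebra structure is $\Delta A=e^{-\omega H/4}\otimes A+A\otimes e^{\omega H/4}$, $\Delta A^\dagger=e^{-\omega H/4}\otimes A^\dagger+A^\dagger\otimes e^{\omega H/4}$, $N,H$ primitive, $e^{\pm\omega H/4}$ grouplike, $\varepsilon(X)=0$ and $S(X)=-X$ for $X=A,A^\dagger,N,H$, and its universal $R$-matrix is $$\mathcal R=e^{-\frac{\omega}{2}(H\otimes N+N\otimes H)}\,e^{\omega\, e^{\omega H/4}A\otimes e^{-\omega H/4}A^\dagger}=\sum\mathcal R^{(1)}\otimes\mathcal R^{(2)}.$$ Let $BU_q(h)$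 be the algebra $U_q(h)$ regarded as a $U_q(h)$-module algebra under the adjoint action $h\triangleright a=h_{(1)}\,a\,S(h_{(2)})$. For $U_q(h)$-module algebras $V,W$ on which $H$ acts by zero, $e^{\omega H/4}$ as the identity and $A$ locally nilpotently (so that the exponentials in $\mathcal R$ act on tensor products by finite sums), let $\Psi(v\otimes w)=\sum \mathcal R^{(2)}\triangleright w\otimes\mathcal R^{(1)}\triangleright v$ be the braiding, and let $V\,\underline\otimes\,W$ be the space $V\otimes W$ with the product $(a\otimes b)(c\otimes d)=a\,\Psi(b\otimes c)\,d$ and with the action given by $\Delta$; it is again such a module algebra. Iterating gives the $n$-fold braided tensor product algebra $BU_q(h)^{\underline\otimes n}$, $n\ge 0$ (for $n=0$ it is $\mathbb C$). For $Y\in U_q(h)$ and $1\le i\le n$ let $Y_i\in U_q(h)^{\otimes n}$ and $\bar Y_i\in BU_q(h)^{\underline\otimes n}$ be the elements with $Y$ in the $i$-th place and $1$ elsewhere. In $BU_q(h)^{\underline\otimes n}$ put $$\bar X_i=e^{-\frac{\omega}{2}\sum_{k<i}\bar H_k}\,\bar A_i,$$ $$\bar X^\dagger_i=e^{\frac{\omega}{2}\sum_{k<i}\bar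 H_k}\,\bar A^\dagger_i-\omega\,[\bar H_i]\,e^{-\frac{\omega}{4}\bar H_i}\sum_{j<i}e^{\frac{\omega}{2}\sum_{k<j}\bar H_k}\,e^{\frac{\omega}{4}\bar H_j}\,e^{-\frac{\omega}{2}\sum_{j<k<i}\bar H_k}\,\bar A^\dagger_j,$$ $$\bar M_i=\bar N_i-\omega\,e^{-\frac{\omega}{4}\bar H_i}\sum_{j<i}e^{-\frac{\omega}{4}\bar H_j}\,e^{-\omega\sum_{j<k<i}\bar H_k}\,\bar A^\dagger_j\bar A_i .$$ Then $[\bar H_i](\bar M_i-\bar N_i)=\bar X^\dagger_i\bar X_i-\bar A^\dagger_i\bar A_i$ for all $i$ (that is, $\bar M_i=\bar N_i+\frac{1}{[\bar H_i]}\{\bar X^\dagger_i\bar X_i-\bar A^\dagger_i\bar A_i\}$), and there is a unique isomorphism of $\mathbb C$-algebras $$\varphi:\ BU_q(h)^{\underline\otimes n}\ \xrightarrow{\ \sim\ }\ U_q(h)^{\otimes n}$$ onto the ordinary tensor product algebra such that, for all $1\le i\le n$, $$\varphi(\bar X_i)=A_i,\qquad \varphi(\bar X^\dagger_i)=A^\dagger_i,\qquad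 \varphi(\bar H_i)=H_i,\qquad \varphi\big(e^{\omega\bar H_i/4}\big)=e^{\omega H_i/4},\qquad \varphi(\bar M_i)=N_i .$$ -/

import Mathlib

open scoped TensorProduct

noncomputable section

namespace BraidedHeisenberg

/-- The generators `A`, `A†`, `N`, `H` of `U_q(h)` together with the exponentials
`K = e^{ωH/4}` and `K⁻¹ = e^{-ωH/4}`. For `ω ≠ 0` the functions `h` and `e^{ωh/4}` of a complex
variable `h` are algebraically independent, so the exponentials are adjoined as a central
invertible grouplike element with no further relation to `H`. -/
inductive Gen
  | A | Ad | N | H | K | Kinv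

/-- The relations of `U_q(h)`: `[A, A†] = ω⁻¹ (e^{ωH/2} - e^{-ωH/2})`, `[N, A] = -A`,
`[N, A†] = A†`, and `H`, `e^{±ωH/4}` central. -/
inductive Rel (ω : ℂ) : FreeAlgebra ℂ Gen → FreeAlgebra ℂ Gen → Prop
  | A_Ad : Rel ω (.ι ℂ .A * .ι ℂ .Ad - .ι ℂ .Ad * .ι ℂ .A)
      (ω⁻¹ • (.ι ℂ .K ^ 2 - .ι ℂ .Kinv ^ 2))
  | N_A : Rel ω (.ι ℂ .N * .ι ℂ .A - .ι ℂ .A * .ι ℂ .N) (-.ι ℂ .A)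
  | N_Ad : Rel ω (.ι ℂ .N * .ι ℂ .Ad - .ι ℂ .Ad * .ι ℂ .N) (.ι ℂ .Ad)
  | H_central (g : Gen) : Rel ω (.ι ℂ .H * .ι ℂ g) (.ι ℂ g * .ι ℂ .H)
  | K_central (g : Gen) : Rel ω (.ι ℂ .K * .ι ℂ g) (.ι ℂ g * .ι ℂ .K)
  | K_Kinv : Rel ω (.ι ℂ .K * .ι ℂ .Kinv) 1
  | Kinv_K : Rel ω (.ι ℂ .Kinv * .ι ℂ .K) 1

/-- The algebra `U_q(h)`. -/
def Uq (ω : ℂ) : Type := RingQuot (Rel ω)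

namespace Uq

variable (ω : ℂ)

instance : Ring (Uq ω) := inferInstanceAs (Ring (RingQuot (Rel ω)))

instance : Algebra ℂ (Uq ω) := inferInstanceAs (Algebra ℂ (RingQuot (Rel ω)))

/-- The quotient map from the free algebra. -/
def mk : FreeAlgebra ℂ Gen →ₐ[ℂ] Uq ω := RingQuot.mkAlgHom ℂ (Rel ω)

theorem mk_rel {x y : FreeAlgebra ℂ Gen} (h : Rel ω x y) : mk ω x = mk ω y :=
  RingQuot.mkAlgHom_rel ℂ h

theorem mk_surjective : Function.Surjective (mk ω) := RingQuot.mkAlgHom_surjective ℂ (Rel ω)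

/-- The class of a generator in `U_q(h)`. -/
def gen (g : Gen) : Uq ω := mk ω (FreeAlgebra.ι ℂ g)

/-- The annihilation generator `A`. -/
abbrev A : Uq ω := gen ω .A

/-- The creation generator `A†`. -/
abbrev Ad : Uq ω := gen ω .Ad

/-- The generator `N`. -/
abbrev N : Uq ω := gen ω .N

/-- The generator `H`. -/
abbrev H : Uq ω := gen ω .H

theorem gen_K_mul_gen_Kinv : gen ω .K * gen ω .Kinv = 1 := by
  have := mk_rel ω (Rel.K_Kinv (ω := ω))
  simpa [gen] using this

theorem gen_Kinv_mul_gen_K : gen ω .Kinv * gen ω .K = 1 := by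
  have := mk_rel ω (Rel.Kinv_K (ω := ω))
  simpa [gen] using this

/-- The invertible element `K = e^{ωH/4}`, so that `K ^ m` is `e^{mωH/4}` for every integer `m`. -/
def K : (Uq ω)ˣ where
  val := gen ω .K
  inv := gen ω .Kinv
  val_inv := gen_K_mul_gen_Kinv ω
  inv_val := gen_Kinv_mul_gen_K ω

/-- `[H] = ω⁻¹ (e^{ωH/2} - e^{-ωH/2})`. -/
def brH : Uq ω := ω⁻¹ • (((K ω ^ 2 : (Uq ω)ˣ) : Uq ω) - ((K ω ^ (-2 : ℤ) : (Uq ω)ˣ) : Uq ω))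

variable {ω}

theorem A_mul_Ad : A ω * Ad ω = Ad ω * A ω + brH ω := by
  have := mk_rel ω (Rel.A_Ad (ω := ω))
  simp only [map_sub, map_mul, map_smul, map_pow] at this
  rw [← sub_eq_iff_eq_add', brH]
  refine this.trans ?_
  congr 2

theorem N_mul_A : N ω * A ω = A ω * N ω - A ω := by
  have := mk_rel ω (Rel.N_A (ω := ω))
  simp only [map_sub, map_mul, map_neg] at this
  rw [sub_eq_add_neg, ← sub_eq_iff_eq_add']
  exact this

theorem N_mul_Ad : N ω * Ad ω = Ad ω * N ω + Ad ω := by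
  have := mk_rel ω (Rel.N_Ad (ω := ω))
  simp only [map_sub, map_mul] at this
  rw [← sub_eq_iff_eq_add']
  exact this

theorem gen_induction {p : Uq ω → Prop} (hg : ∀ g, p (gen ω g))
    (hc : ∀ c : ℂ, p (algebraMap ℂ (Uq ω) c)) (ha : ∀ x y, p x → p y → p (x + y))
    (hm : ∀ x y, p x → p y → p (x * y)) (x : Uq ω) : p x := by
  obtain ⟨y, rfl⟩ := mk_surjective ω x
  induction y using FreeAlgebra.induction with
  | grade0 r =>
    rw [AlgHom.commutes]
    exact hc r
  | grade1 g => exact hg g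
  | mul a b iha ihb => rw [map_mul]; exact hm _ _ iha ihb
  | add a b iha ihb => rw [map_add]; exact ha _ _ iha ihb

theorem H_comm (x : Uq ω) : H ω * x = x * H ω := by
  induction x using gen_induction with
  | hg g =>
    have := mk_rel ω (Rel.H_central (ω := ω) g)
    rw [map_mul, map_mul] at this
    exact this
  | hc c => exact (Algebra.commutes c _).symm
  | ha x y hx hy => rw [mul_add, add_mul, hx, hy]
  | hm x y hx hy => rw [← mul_assoc, hx, mul_assoc, hy, mul_assoc]

theorem K_comm (x : Uq ω) : (K ω : Uq ω) * x = x * K ω := by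
  induction x using gen_induction with
  | hg g =>
    have := mk_rel ω (Rel.K_central (ω := ω) g)
    rw [map_mul, map_mul] at this
    exact this
  | hc c => exact (Algebra.commutes c _).symm
  | ha x y hx hy => rw [mul_add, add_mul, hx, hy]
  | hm x y hx hy => rw [← mul_assoc, hx, mul_assoc, hy, mul_assoc]

theorem Kinv_comm (x : Uq ω) : ((K ω)⁻¹ : (Uq ω)ˣ) * x = x * ((K ω)⁻¹ : (Uq ω)ˣ) := by
  have h : Commute ((K ω : (Uq ω)ˣ) : Uq ω) x := K_comm x
  exact h.units_inv_left

/-- A family of elements of an algebra satisfying the relations of `U_q(h)` defines an algebra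
homomorphism out of `U_q(h)`. -/
def lift {B : Type*} [Ring B] [Algebra ℂ B] (f : Gen → B)
    (hA : f .A * f .Ad = f .Ad * f .A + ω⁻¹ • (f .K ^ 2 - f .Kinv ^ 2))
    (hNA : f .N * f .A = f .A * f .N - f .A) (hNAd : f .N * f .Ad = f .Ad * f .N + f .Ad)
    (hH : ∀ g, f .H * f g = f g * f .H) (hK : ∀ g, f .K * f g = f g * f .K)
    (h₁ : f .K * f .Kinv = 1) (h₂ : f .Kinv * f .K = 1) : Uq ω →ₐ[ℂ] B :=
  RingQuot.liftAlgHom ℂ ⟨FreeAlgebra.lift ℂ f, by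
    intro x y h
    cases h <;>
      simp only [map_sub, map_mul, map_smul, map_pow, map_neg, map_one, FreeAlgebra.lift_ι_apply]
    · rw [hA]; abel
    · rw [hNA]; abel
    · rw [hNAd]; abel
    · exact hH _
    · exact hK _
    · exact h₁
    · exact h₂⟩

theorem lift_gen {B : Type*} [Ring B] [Algebra ℂ B] (f : Gen → B) (hA hNA hNAd hH hK h₁ h₂)
    (g : Gen) : lift (ω := ω) f hA hNA hNAd hH hK h₁ h₂ (gen ω g) = f g := by
  refine (RingQuot.liftAlgHom_mkAlgHom_apply ℂ _ _ _).trans ?_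
  simp


theorem gen_K : gen ω .K = K ω := rfl

theorem gen_Kinv : gen ω .Kinv = ((K ω)⁻¹ : (Uq ω)ˣ) := rfl

theorem brH_eq : brH ω = ω⁻¹ • (gen ω .K ^ 2 - gen ω .Kinv ^ 2) := rfl

variable (ω)

/-- The coproduct on generators: `Δ A = e^{-ωH/4} ⊗ A + A ⊗ e^{ωH/4}`,
`Δ A† = e^{-ωH/4} ⊗ A† + A† ⊗ e^{ωH/4}`, `N` and `H` primitive, `e^{±ωH/4}` grouplike. -/
def comulGen : Gen → Uq ω ⊗[ℂ] Uq ω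
  | .A => gen ω .Kinv ⊗ₜ A ω + A ω ⊗ₜ gen ω .K
  | .Ad => gen ω .Kinv ⊗ₜ Ad ω + Ad ω ⊗ₜ gen ω .K
  | .N => N ω ⊗ₜ 1 + 1 ⊗ₜ N ω
  | .H => H ω ⊗ₜ 1 + 1 ⊗ₜ H ω
  | .K => gen ω .K ⊗ₜ gen ω .K
  | .Kinv => gen ω .Kinv ⊗ₜ gen ω .Kinv

/-- The coproduct `Δ` of `U_q(h)`. -/
def comul : Uq ω →ₐ[ℂ] Uq ω ⊗[ℂ] Uq ω :=
  lift (comulGen ω)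
    (by
      simp only [comulGen, mul_add, add_mul, Algebra.TensorProduct.tmul_mul_tmul, pow_two,
        A_mul_Ad, TensorProduct.tmul_add, TensorProduct.add_tmul, brH_eq, gen_Kinv, gen_K,
        K_comm (A ω), K_comm (Ad ω), Kinv_comm (A ω), Kinv_comm (Ad ω),
        TensorProduct.tmul_smul, ← TensorProduct.smul_tmul', TensorProduct.tmul_sub,
        TensorProduct.sub_tmul, smul_sub]
      abel)
    (by
      simp only [comulGen, mul_add, add_mul, Algebra.TensorProduct.tmul_mul_tmul,
        N_mul_A, TensorProduct.tmul_sub, TensorProduct.sub_tmul, gen_Kinv, gen_K, one_mul, mul_one,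
        K_comm (N ω), Kinv_comm (N ω)]
      abel)
    (by
      simp only [comulGen, mul_add, add_mul, Algebra.TensorProduct.tmul_mul_tmul,
        N_mul_Ad, TensorProduct.tmul_add, TensorProduct.add_tmul, gen_Kinv, gen_K, one_mul,
        mul_one, K_comm (N ω), Kinv_comm (N ω)]
      abel)
    (by
      intro g
      cases g <;>
      simp only [comulGen, mul_add, add_mul, Algebra.TensorProduct.tmul_mul_tmul, one_mul,
        mul_one, H_comm (A ω), H_comm (Ad ω), H_comm (N ω), H_comm (gen ω .K),
        H_comm (gen ω .Kinv)] <;> abel)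
    (by
      intro g
      cases g <;>
      simp only [comulGen, mul_add, add_mul, Algebra.TensorProduct.tmul_mul_tmul, one_mul,
        mul_one, gen_K, K_comm (A ω), K_comm (Ad ω), K_comm (N ω), K_comm (H ω),
        K_comm (gen ω .Kinv)])
    (by
      simp only [comulGen, Algebra.TensorProduct.tmul_mul_tmul, gen_K_mul_gen_Kinv,
        Algebra.TensorProduct.one_def])
    (by
      simp only [comulGen, Algebra.TensorProduct.tmul_mul_tmul, gen_Kinv_mul_gen_K,
        Algebra.TensorProduct.one_def])

theorem comul_gen (g : Gen) : comul ω (gen ω g) = comulGen ω g := lift_gen _ _ _ _ _ _ _ _ _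

/-- The counit on generators. -/
def counitGen : Gen → ℂ
  | .A | .Ad | .N | .H => 0
  | .K | .Kinv => 1

/-- The counit `ε` of `U_q(h)`. -/
def counit : Uq ω →ₐ[ℂ] ℂ :=
  lift counitGen (by simp [counitGen]) (by simp [counitGen]) (by simp [counitGen])
    (fun _ => mul_comm _ _) (fun _ => mul_comm _ _) (by simp [counitGen]) (by simp [counitGen])

theorem counit_gen (g : Gen) : counit ω (gen ω g) = counitGen g := lift_gen _ _ _ _ _ _ _ _ _

/-- The antipode on generators: `S X = -X` for `X = A, A†, N, H`, and `S e^{±ωH/4} = e^{∓ωH/4}`. -/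
def antipodeGen : Gen → (Uq ω)ᵐᵒᵖ
  | .A => .op (-A ω)
  | .Ad => .op (-Ad ω)
  | .N => .op (-N ω)
  | .H => .op (-H ω)
  | .K => .op (gen ω .Kinv)
  | .Kinv => .op (gen ω .K)

/-- The antipode `S` of `U_q(h)`, as an algebra homomorphism to the opposite algebra. -/
def antipode : Uq ω →ₐ[ℂ] (Uq ω)ᵐᵒᵖ :=
  lift (antipodeGen ω)
    (by
      simp only [antipodeGen, ← MulOpposite.op_mul, neg_mul_neg, A_mul_Ad, brH_eq,
        ← MulOpposite.op_pow, ← MulOpposite.op_sub, ← MulOpposite.op_smul, ← MulOpposite.op_add,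
        smul_sub]
      congr 1
      abel)
    (by
      simp only [antipodeGen, ← MulOpposite.op_mul, neg_mul_neg, N_mul_A, ← MulOpposite.op_sub]
      congr 1
      abel)
    (by
      simp only [antipodeGen, ← MulOpposite.op_mul, neg_mul_neg, N_mul_Ad, ← MulOpposite.op_add]
      congr 1
      abel)
    (by
      intro g
      cases g <;>
      simp only [antipodeGen, ← MulOpposite.op_mul, neg_mul, mul_neg, H_comm (A ω),
        H_comm (Ad ω), H_comm (N ω), H_comm (gen ω .K), H_comm (gen ω .Kinv)])
    (by
      intro g
      cases g <;>
      simp only [antipodeGen, ← MulOpposite.op_mul, neg_mul, mul_neg, gen_Kinv, gen_K,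
        Kinv_comm (A ω), Kinv_comm (Ad ω), Kinv_comm (N ω), Kinv_comm (H ω), Kinv_comm (K ω : Uq ω)])
    (by simp only [antipodeGen, ← MulOpposite.op_mul, gen_K_mul_gen_Kinv, MulOpposite.op_one])
    (by simp only [antipodeGen, ← MulOpposite.op_mul, gen_Kinv_mul_gen_K, MulOpposite.op_one])

theorem antipode_gen (g : Gen) : antipode ω (gen ω g) = antipodeGen ω g :=
  lift_gen _ _ _ _ _ _ _ _ _

/-- The quantum adjoint action `h ▷ a = h₍₁₎ a S(h₍₂₎)` of `U_q(h)` on itself. -/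
def adjoint : Uq ω →ₐ[ℂ] Module.End ℂ (Uq ω) :=
  (AlgHom.mulLeftRight ℂ (Uq ω)).comp
    ((Algebra.TensorProduct.map (AlgHom.id ℂ (Uq ω)) (antipode ω)).comp (comul ω))

theorem adjoint_A (x : Uq ω) : adjoint ω (A ω) x = gen ω .Kinv * (A ω * x - x * A ω) := by
  simp only [adjoint, AlgHom.comp_apply, comul_gen, comulGen, map_add,
    Algebra.TensorProduct.map_tmul, antipode_gen, antipodeGen, LinearMap.add_apply,
    AlgHom.mulLeftRight_apply, AlgHom.id_apply, MulOpposite.unop_op]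
  rw [gen_Kinv, ← Kinv_comm (A ω * x)]
  noncomm_ring

theorem adjoint_Ad (x : Uq ω) : adjoint ω (Ad ω) x = gen ω .Kinv * (Ad ω * x - x * Ad ω) := by
  simp only [adjoint, AlgHom.comp_apply, comul_gen, comulGen, map_add,
    Algebra.TensorProduct.map_tmul, antipode_gen, antipodeGen, LinearMap.add_apply,
    AlgHom.mulLeftRight_apply, AlgHom.id_apply, MulOpposite.unop_op]
  rw [gen_Kinv, ← Kinv_comm (Ad ω * x)]
  noncomm_ring

theorem adjoint_N (x : Uq ω) : adjoint ω (N ω) x = N ω * x - x * N ω := by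
  simp only [adjoint, AlgHom.comp_apply, comul_gen, comulGen, map_add,
    Algebra.TensorProduct.map_tmul, antipode_gen, antipodeGen, LinearMap.add_apply,
    AlgHom.mulLeftRight_apply, AlgHom.id_apply, MulOpposite.unop_op, map_one, MulOpposite.unop_one]
  noncomm_ring

theorem adjoint_H : adjoint ω (H ω) = 0 := by
  ext x
  simp only [adjoint, AlgHom.comp_apply, comul_gen, comulGen, map_add,
    Algebra.TensorProduct.map_tmul, antipode_gen, antipodeGen, LinearMap.add_apply,
    AlgHom.mulLeftRight_apply, AlgHom.id_apply, MulOpposite.unop_op, map_one, MulOpposite.unop_one]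
  rw [H_comm, LinearMap.zero_apply]
  noncomm_ring

theorem adjoint_K : adjoint ω (gen ω .K) = 1 := by
  ext x
  simp only [adjoint, AlgHom.comp_apply, comul_gen, comulGen,
    Algebra.TensorProduct.map_tmul, antipode_gen, antipodeGen,
    AlgHom.mulLeftRight_apply, AlgHom.id_apply, MulOpposite.unop_op, Module.End.one_apply]
  rw [gen_K, K_comm, mul_assoc, ← gen_K, gen_K_mul_gen_Kinv, mul_one]

end Uq

/-- The action of `U_q(h)` on a tensor product of two modules, `h ▷ (v ⊗ w) = h₍₁₎ ▷ v ⊗ h₍₂₎ ▷ w`. -/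
def tensorAct {ω : ℂ} {V W : Type*} [AddCommGroup V] [Module ℂ V] [AddCommGroup W] [Module ℂ W]
    (f : Uq ω →ₐ[ℂ] Module.End ℂ V) (g : Uq ω →ₐ[ℂ] Module.End ℂ W) :
    Uq ω →ₐ[ℂ] Module.End ℂ (V ⊗[ℂ] W) :=
  (Module.endTensorEndAlgHom (R := ℂ) (S := ℂ) (A := ℂ) (M := V) (N := W)).comp
    ((Algebra.TensorProduct.map f g).comp (Uq.comul ω))

/-- A locally nilpotent operator. -/
def LocNil {V : Type*} [AddCommGroup V] [Module ℂ V] (T : Module.End ℂ V) : Prop :=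
  ∀ v, ∃ n : ℕ, (T ^ n) v = 0

section LocNil

variable {V W : Type*} [AddCommGroup V] [Module ℂ V] [AddCommGroup W] [Module ℂ W]

theorem pow_apply_eq_zero_of_le {T : Module.End ℂ V} {v : V} {m n : ℕ} (hmn : m ≤ n)
    (h : (T ^ m) v = 0) : (T ^ n) v = 0 := by
  obtain ⟨k, rfl⟩ := Nat.exists_eq_add_of_le hmn
  rw [add_comm, pow_add, Module.End.mul_apply, h, map_zero]

theorem finsum_exp_eq {T : Module.End ℂ V} {v : V} {n : ℕ} (h : (T ^ n) v = 0) :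
    ∑ᶠ k : ℕ, ((k.factorial : ℂ)⁻¹ • (T ^ k) v)
      = ∑ k ∈ Finset.range n, ((k.factorial : ℂ)⁻¹ • (T ^ k) v) := by
  apply finsum_eq_sum_of_support_subset
  intro k hk
  simp only [Finset.coe_range, Set.mem_Iio]
  by_contra hkn
  exact hk (by simp [pow_apply_eq_zero_of_le (not_lt.1 hkn) h])

/-- The exponential `exp T = ∑ₖ Tᵏ / k!` of a locally nilpotent operator: for each vector only
finitely many terms of the sum are non-zero. -/
def locExp (T : Module.End ℂ V) (hT : LocNil T) : Module.End ℂ V where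
  toFun v := ∑ᶠ k : ℕ, ((k.factorial : ℂ)⁻¹ • (T ^ k) v)
  map_add' x y := by
    obtain ⟨m, hm⟩ := hT x
    obtain ⟨n, hn⟩ := hT y
    have hm' := pow_apply_eq_zero_of_le (le_max_left m n) hm
    have hn' := pow_apply_eq_zero_of_le (le_max_right m n) hn
    rw [finsum_exp_eq hm', finsum_exp_eq hn', finsum_exp_eq (n := max m n) (by simp [hm', hn']),
      ← Finset.sum_add_distrib]
    simp
  map_smul' c x := by
    obtain ⟨m, hm⟩ := hT x
    rw [finsum_exp_eq hm, finsum_exp_eq (n := m) (by simp [hm]), Finset.smul_sum]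
    simp [smul_comm c]

theorem locExp_apply {T : Module.End ℂ V} (hT : LocNil T) {v : V} {n : ℕ} (h : (T ^ n) v = 0) :
    locExp T hT v = ∑ k ∈ Finset.range n, ((k.factorial : ℂ)⁻¹ • (T ^ k) v) := finsum_exp_eq h

theorem locNil_zero : LocNil (0 : Module.End ℂ V) := fun v => ⟨1, by simp⟩

theorem locExp_eq_one {T : Module.End ℂ V} (hT : LocNil T) (h : T = 0) : locExp T hT = 1 := by
  ext v
  rw [locExp_apply hT (n := 1) (by simp [h])]
  simp

theorem locExp_comm {T P : Module.End ℂ V} (hT : LocNil T) (h : P * T = T * P) :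
    P * locExp T hT = locExp T hT * P := by
  ext v
  have hk : ∀ k, P ((T ^ k) v) = (T ^ k) (P v) := fun k =>
    congrArg (fun S : Module.End ℂ V => S v) ((show Commute P T from h).pow_right k)
  obtain ⟨n, hn⟩ := hT v
  rw [Module.End.mul_apply, Module.End.mul_apply, locExp_apply hT hn,
    locExp_apply hT (n := n) (by rw [← hk, hn, map_zero])]
  simp [hk]

theorem LocNil.of_tmul {T : Module.End ℂ (V ⊗[ℂ] W)}
    (h : ∀ v w, ∃ n : ℕ, (T ^ n) (v ⊗ₜ w) = 0) : LocNil T := by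
  intro t
  induction t with
  | zero => exact ⟨0, by simp⟩
  | tmul v w => exact h v w
  | add x y hx hy =>
    obtain ⟨m, hm⟩ := hx
    obtain ⟨n, hn⟩ := hy
    exact ⟨max m n, by simp [pow_apply_eq_zero_of_le (le_max_left m n) hm,
      pow_apply_eq_zero_of_le (le_max_right m n) hn]⟩

theorem LocNil.smul_map {S : Module.End ℂ V} (hS : LocNil S) (c : ℂ) (T : Module.End ℂ W) :
    LocNil (c • TensorProduct.map S T) := by
  refine LocNil.of_tmul fun v w => ?_
  obtain ⟨n, hn⟩ := hS v
  exact ⟨n, by rw [smul_pow, TensorProduct.map_pow]; simp [hn]⟩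

theorem LocNil.sum_map {S : Module.End ℂ V} (hS : LocNil S) {T : Module.End ℂ W} (hT : LocNil T) :
    LocNil (TensorProduct.map 1 T + TensorProduct.map S 1) := by
  refine LocNil.of_tmul fun v w => ?_
  obtain ⟨m, hm⟩ := hS v
  obtain ⟨n, hn⟩ := hT w
  refine ⟨m + n, ?_⟩
  have hc : Commute (TensorProduct.map (1 : Module.End ℂ V) T)
      (TensorProduct.map S (1 : Module.End ℂ W)) := by
    rw [Commute, SemiconjBy, ← TensorProduct.map_mul, ← TensorProduct.map_mul]
    simp
  rw [hc.add_pow', LinearMap.sum_apply]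
  refine Finset.sum_eq_zero fun p hp => ?_
  rw [TensorProduct.map_pow, TensorProduct.map_pow, ← TensorProduct.map_mul]
  simp only [one_pow, mul_one, one_mul, LinearMap.smul_apply, TensorProduct.map_tmul]
  rw [Finset.HasAntidiagonal.mem_antidiagonal] at hp
  rcases le_or_gt m p.2 with h | h
  · rw [pow_apply_eq_zero_of_le h hm]; simp
  · rw [pow_apply_eq_zero_of_le (show n ≤ p.1 by omega) hn]; simp

end LocNil

/-- An algebra in the braided category of `U_q(h)`-modules, among the modules on which `H` acts by
zero (so `e^{ωH/4}` acts as the identity) and `A` acts locally nilpotently. On tensor products of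
such modules the exponential series in the universal `R`-matrix are finite sums. -/
structure ModAlg (ω : ℂ) where
  /-- The underlying algebra. -/
  carrier : Type
  [ring : Ring carrier]
  [algebra : Algebra ℂ carrier]
  /-- The action `h ▷ x`. -/
  act : Uq ω →ₐ[ℂ] Module.End ℂ carrier
  act_one : ∀ h, act h 1 = Uq.counit ω h • (1 : carrier)
  act_mul : ∀ h t, act h (LinearMap.mul' ℂ carrier t)
    = LinearMap.mul' ℂ carrier (tensorAct act act h t)
  act_H : act (Uq.H ω) = 0
  act_K : act (Uq.K ω) = 1
  act_A_locNil : LocNil (act (Uq.A ω))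

attribute [instance] ModAlg.ring ModAlg.algebra

namespace ModAlg

variable {ω : ℂ} (X Y : ModAlg ω)

theorem act_gen_K : X.act (Uq.gen ω .K) = 1 := X.act_K

theorem act_gen_Kinv : X.act (Uq.gen ω .Kinv) = 1 := by
  have h := congrArg X.act (Uq.gen_K_mul_gen_Kinv ω)
  rwa [map_mul, act_gen_K, one_mul, map_one] at h

theorem act_A_comm_act_Ad :
    X.act (Uq.A ω) * X.act (Uq.Ad ω) = X.act (Uq.Ad ω) * X.act (Uq.A ω) := by
  rw [← map_mul, ← map_mul, Uq.A_mul_Ad, map_add, Uq.brH_eq, map_smul, map_sub, map_pow, map_pow,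
    act_gen_K, act_gen_Kinv]
  simp

theorem tensorAct_apply {h : Uq ω} {s : Uq ω ⊗[ℂ] Uq ω} (hs : Uq.comul ω h = s) :
    tensorAct X.act Y.act h = Module.endTensorEndAlgHom (R := ℂ) (S := ℂ) (A := ℂ)
      (Algebra.TensorProduct.map X.act Y.act s) := by
  rw [← hs]; rfl

theorem end_tmul {V W : Type*} [AddCommGroup V] [Module ℂ V] [AddCommGroup W] [Module ℂ W]
    (f : Module.End ℂ V) (g : Module.End ℂ W) :
    Module.endTensorEndAlgHom (R := ℂ) (S := ℂ) (A := ℂ) (f ⊗ₜ[ℂ] g) = TensorProduct.map f g := rfl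

theorem tensorAct_A : tensorAct X.act Y.act (Uq.A ω)
    = TensorProduct.map 1 (Y.act (Uq.A ω)) + TensorProduct.map (X.act (Uq.A ω)) 1 := by
  rw [tensorAct_apply X Y (Uq.comul_gen ω .A)]
  simp only [Uq.comulGen, map_add, Algebra.TensorProduct.map_tmul, end_tmul, act_gen_K,
    act_gen_Kinv]

theorem tensorAct_Ad : tensorAct X.act Y.act (Uq.Ad ω)
    = TensorProduct.map 1 (Y.act (Uq.Ad ω)) + TensorProduct.map (X.act (Uq.Ad ω)) 1 := by
  rw [tensorAct_apply X Y (Uq.comul_gen ω .Ad)]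
  simp only [Uq.comulGen, map_add, Algebra.TensorProduct.map_tmul, end_tmul, act_gen_K,
    act_gen_Kinv]

theorem tensorAct_N : tensorAct X.act Y.act (Uq.N ω)
    = TensorProduct.map 1 (Y.act (Uq.N ω)) + TensorProduct.map (X.act (Uq.N ω)) 1 := by
  rw [tensorAct_apply X Y (Uq.comul_gen ω .N)]
  simp only [Uq.comulGen, map_add, Algebra.TensorProduct.map_tmul, end_tmul, map_one]
  exact add_comm _ _

theorem tensorAct_H : tensorAct X.act Y.act (Uq.H ω) = 0 := by
  rw [tensorAct_apply X Y (Uq.comul_gen ω .H)]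
  simp only [Uq.comulGen, map_add, Algebra.TensorProduct.map_tmul, end_tmul, act_H,
    TensorProduct.map_zero_left, TensorProduct.map_zero_right, add_zero]

theorem tensorAct_gen_K : tensorAct X.act Y.act (Uq.gen ω .K) = 1 := by
  rw [tensorAct_apply X Y (Uq.comul_gen ω .K)]
  simp only [Uq.comulGen, Algebra.TensorProduct.map_tmul, end_tmul, act_gen_K,
    TensorProduct.map_one]

theorem tensorAct_gen_Kinv : tensorAct X.act Y.act (Uq.gen ω .Kinv) = 1 := by
  rw [tensorAct_apply X Y (Uq.comul_gen ω .Kinv)]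
  simp only [Uq.comulGen, Algebra.TensorProduct.map_tmul, end_tmul, act_gen_Kinv,
    TensorProduct.map_one]

/-- `A`, `A†` and `N` act as derivations. -/
theorem act_leibniz {h : Uq ω} (hh : tensorAct X.act X.act h
    = TensorProduct.map 1 (X.act h) + TensorProduct.map (X.act h) 1) (x y : X.carrier) :
    X.act h (x * y) = x * X.act h y + X.act h x * y := by
  simpa [hh] using X.act_mul h (x ⊗ₜ y)

/-- The exponent `-ω/2 (H ⊗ N + N ⊗ H)` of the universal `R`-matrix, acting on `X ⊗ Y`. -/
def exponentHN : Module.End ℂ (X.carrier ⊗[ℂ] Y.carrier) :=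
  (-ω / 2) • (TensorProduct.map (X.act (Uq.H ω)) (Y.act (Uq.N ω))
    + TensorProduct.map (X.act (Uq.N ω)) (Y.act (Uq.H ω)))

/-- The exponent `ω e^{ωH/4} A ⊗ e^{-ωH/4} A†` of the universal `R`-matrix, acting on `X ⊗ Y`. -/
def exponentA : Module.End ℂ (X.carrier ⊗[ℂ] Y.carrier) :=
  ω • TensorProduct.map (X.act (Uq.K ω * Uq.A ω))
    (Y.act (((Uq.K ω)⁻¹ : (Uq ω)ˣ) * Uq.Ad ω))

theorem exponentHN_eq : exponentHN X Y = 0 := by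
  simp [exponentHN, act_H]

theorem exponentA_eq : exponentA X Y
    = ω • TensorProduct.map (X.act (Uq.A ω)) (Y.act (Uq.Ad ω)) := by
  rw [exponentA, map_mul, map_mul, act_K, ← Uq.gen_Kinv, act_gen_Kinv, one_mul, one_mul]

theorem exponentHN_locNil : LocNil (exponentHN X Y) := by
  rw [exponentHN_eq]; exact locNil_zero

theorem exponentA_locNil : LocNil (exponentA X Y) := by
  rw [exponentA_eq]; exact X.act_A_locNil.smul_map _ _

/-- The action on `X ⊗ Y` of the universal `R`-matrix
`ℛ = e^{-ω/2 (H ⊗ N + N ⊗ H)} e^{ω e^{ωH/4} A ⊗ e^{-ωH/4} A†}`. -/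
def rMatrix : Module.End ℂ (X.carrier ⊗[ℂ] Y.carrier) :=
  locExp (exponentHN X Y) (exponentHN_locNil X Y) * locExp (exponentA X Y) (exponentA_locNil X Y)

/-- The braiding `Ψ(v ⊗ w) = ℛ⁽²⁾ ▷ w ⊗ ℛ⁽¹⁾ ▷ v`. -/
def braiding : X.carrier ⊗[ℂ] Y.carrier →ₗ[ℂ] Y.carrier ⊗[ℂ] X.carrier :=
  (TensorProduct.comm ℂ X.carrier Y.carrier).toLinearMap ∘ₗ rMatrix X Y

theorem rMatrix_eq : rMatrix X Y = locExp (exponentA X Y) (exponentA_locNil X Y) := by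
  rw [rMatrix, locExp_eq_one _ (exponentHN_eq X Y), one_mul]

theorem braiding_tmul {x : X.carrier} {n : ℕ} (hn : (X.act (Uq.A ω) ^ n) x = 0) (y : Y.carrier) :
    braiding X Y (x ⊗ₜ y) = ∑ k ∈ Finset.range n, (ω ^ k * (k.factorial : ℂ)⁻¹) •
      ((Y.act (Uq.Ad ω) ^ k) y ⊗ₜ[ℂ] (X.act (Uq.A ω) ^ k) x) := by
  have hpow : ∀ k, (exponentA X Y ^ k) (x ⊗ₜ y)
      = ω ^ k • ((X.act (Uq.A ω) ^ k) x ⊗ₜ[ℂ] (Y.act (Uq.Ad ω) ^ k) y) := by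
    intro k
    rw [exponentA_eq, smul_pow, TensorProduct.map_pow]
    simp
  rw [braiding, LinearMap.comp_apply, rMatrix_eq, locExp_apply _ (n := n) (by simp [hpow, hn])]
  simp only [hpow, map_sum, map_smul, LinearEquiv.coe_coe, TensorProduct.comm_tmul, smul_smul]
  simp only [mul_comm]

theorem braiding_comm {h : Uq ω}
    (h₁ : Commute (tensorAct X.act Y.act h) (exponentA X Y))
    (h₂ : tensorAct X.act Y.act h
      = TensorProduct.map 1 (Y.act h) + TensorProduct.map (X.act h) 1)
    (h₃ : tensorAct Y.act X.act h
      = TensorProduct.map 1 (X.act h) + TensorProduct.map (Y.act h) 1)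
    (t : X.carrier ⊗[ℂ] Y.carrier) :
    braiding X Y (tensorAct X.act Y.act h t) = tensorAct Y.act X.act h (braiding X Y t) := by
  have e := congrArg (fun f => f t) (locExp_comm (exponentA_locNil X Y) h₁)
  simp only [Module.End.mul_apply] at e
  simp only [braiding, LinearMap.comp_apply, rMatrix_eq, LinearEquiv.coe_coe]
  rw [← e, h₂, h₃]
  generalize locExp _ _ t = s
  induction s with
  | zero => simp
  | tmul a b => simp [add_comm]
  | add a b ha hb => simp only [map_add, ha, hb]

/-- The underlying space of the braided tensor product of `X` and `Y`. -/
def BTensor : Type := X.carrier ⊗[ℂ] Y.carrier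

instance : AddCommGroup (BTensor X Y) :=
  inferInstanceAs (AddCommGroup (X.carrier ⊗[ℂ] Y.carrier))

instance : Module ℂ (BTensor X Y) :=
  inferInstanceAs (Module ℂ (X.carrier ⊗[ℂ] Y.carrier))

/-- The product `(a ⊗ b)(c ⊗ d) = a Ψ(b ⊗ c) d` of the braided tensor product, as the composite
`(· ⊗ ·) ∘ (id ⊗ Ψ ⊗ id)`. -/
def braidedMul : (X.carrier ⊗[ℂ] Y.carrier) ⊗[ℂ] (X.carrier ⊗[ℂ] Y.carrier) →ₗ[ℂ]
    X.carrier ⊗[ℂ] Y.carrier :=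
  TensorProduct.map (LinearMap.mul' ℂ X.carrier) (LinearMap.mul' ℂ Y.carrier)
    ∘ₗ (TensorProduct.assoc ℂ X.carrier X.carrier (Y.carrier ⊗[ℂ] Y.carrier)).symm.toLinearMap
    ∘ₗ LinearMap.lTensor X.carrier
        ((TensorProduct.assoc ℂ X.carrier Y.carrier Y.carrier).toLinearMap
          ∘ₗ LinearMap.rTensor Y.carrier (braiding Y X)
          ∘ₗ (TensorProduct.assoc ℂ Y.carrier X.carrier Y.carrier).symm.toLinearMap)
    ∘ₗ (TensorProduct.assoc ℂ X.carrier Y.carrier (X.carrier ⊗[ℂ] Y.carrier)).toLinearMap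

theorem braidedMul_tmul (a c : X.carrier) (b d : Y.carrier) :
    braidedMul X Y ((a ⊗ₜ b) ⊗ₜ (c ⊗ₜ d))
      = TensorProduct.map (LinearMap.mulLeft ℂ a) (LinearMap.mulRight ℂ d)
          (braiding Y X (b ⊗ₜ c)) := by
  simp only [braidedMul, LinearMap.comp_apply, LinearEquiv.coe_coe, TensorProduct.assoc_tmul,
    LinearMap.lTensor_tmul, TensorProduct.assoc_symm_tmul, LinearMap.rTensor_tmul]
  generalize braiding Y X (b ⊗ₜ c) = s
  induction s with
  | zero => simp
  | tmul x y => simp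
  | add x y hx hy => simp only [TensorProduct.add_tmul, TensorProduct.tmul_add, map_add, hx, hy]

theorem braidedMul_tmul_eq_sum (a c : X.carrier) {b : Y.carrier} (d : Y.carrier) {n : ℕ}
    (hn : (Y.act (Uq.A ω) ^ n) b = 0) :
    braidedMul X Y ((a ⊗ₜ b) ⊗ₜ (c ⊗ₜ d)) = ∑ k ∈ Finset.range n,
      (ω ^ k * (k.factorial : ℂ)⁻¹) •
        ((a * (X.act (Uq.Ad ω) ^ k) c) ⊗ₜ[ℂ] ((Y.act (Uq.A ω) ^ k) b * d)) := by
  rw [braidedMul_tmul, braiding_tmul Y X hn]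
  simp

theorem sum_antidiagonal_eq {V : Type*} [AddCommGroup V] {n : ℕ} (f : ℕ → ℕ → V)
    (h₁ : ∀ p q, n ≤ p → f p q = 0) (h₂ : ∀ p q, n ≤ q → f p q = 0) :
    ∑ l ∈ Finset.range (2 * n), ∑ x ∈ Finset.HasAntidiagonal.antidiagonal l, f x.1 x.2
      = ∑ p ∈ Finset.range n, ∑ q ∈ Finset.range n, f p q := by
  rw [← Finset.sum_product', ← Finset.sum_fiberwise_of_maps_to
    (s := Finset.range n ×ˢ Finset.range n) (t := Finset.range (2 * n)) (g := fun x => x.1 + x.2)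
    (by intro x hx; simp only [Finset.mem_product, Finset.mem_range] at hx ⊢; omega)]
  refine Finset.sum_congr rfl fun l _ => (Finset.sum_subset ?_ ?_).symm
  · intro x hx
    simp only [Finset.mem_filter] at hx
    simpa using hx.2
  · intro x hx hx'
    simp only [Finset.mem_filter, Finset.mem_product, Finset.mem_range, not_and] at hx'
    rw [Finset.HasAntidiagonal.mem_antidiagonal] at hx
    by_cases h : n ≤ x.1
    · exact h₁ _ _ h
    · by_cases h' : n ≤ x.2
      · exact h₂ _ _ h'
      · exact absurd hx (hx' ⟨not_le.1 h, not_le.1 h'⟩)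

theorem pow_leibniz {h : Uq ω} (hh : tensorAct X.act X.act h
    = TensorProduct.map 1 (X.act h) + TensorProduct.map (X.act h) 1) (l : ℕ) (x y : X.carrier) :
    (ω ^ l * (l.factorial : ℂ)⁻¹) • (X.act h ^ l) (x * y)
      = ∑ p ∈ Finset.HasAntidiagonal.antidiagonal l,
        ((ω ^ p.1 * (p.1.factorial : ℂ)⁻¹) * (ω ^ p.2 * (p.2.factorial : ℂ)⁻¹)) •
          ((X.act h ^ p.1) x * (X.act h ^ p.2) y) := by
  have hc : Commute (TensorProduct.map (X.act h) (1 : Module.End ℂ X.carrier))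
      (TensorProduct.map (1 : Module.End ℂ X.carrier) (X.act h)) := by
    rw [Commute, SemiconjBy, ← TensorProduct.map_mul, ← TensorProduct.map_mul]
    simp
  have e := X.act_mul (h ^ l) (x ⊗ₜ y)
  rw [map_pow, map_pow, hh, add_comm, hc.add_pow'] at e
  rw [LinearMap.mul'_apply] at e
  rw [e, LinearMap.sum_apply, map_sum, Finset.smul_sum]
  refine Finset.sum_congr rfl fun p hp => ?_
  rw [Finset.HasAntidiagonal.mem_antidiagonal] at hp
  rw [TensorProduct.map_pow, TensorProduct.map_pow, ← TensorProduct.map_mul]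
  simp only [one_pow, mul_one, one_mul, LinearMap.smul_apply, TensorProduct.map_tmul, map_nsmul,
    LinearMap.mul'_apply]
  rw [← Nat.cast_smul_eq_nsmul ℂ, smul_smul]
  congr 1
  have hl : p.1 ≤ l := by omega
  rw [Nat.cast_choose ℂ hl, show l - p.1 = p.2 by omega, ← hp, pow_add]
  have := Nat.cast_ne_zero (R := ℂ).2 (p.1 + p.2).factorial_ne_zero
  have := Nat.cast_ne_zero (R := ℂ).2 p.1.factorial_ne_zero
  have := Nat.cast_ne_zero (R := ℂ).2 p.2.factorial_ne_zero
  field_simp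

theorem pow_mul_eq_zero {V : Type*} [Ring V] [Algebra ℂ V] {D : Module.End ℂ V}
    (hD : ∀ x y, D (x * y) = x * D y + D x * y) {x y : V} {n : ℕ} (hx : (D ^ n) x = 0)
    (hy : (D ^ n) y = 0) : (D ^ (2 * n)) (x * y) = 0 := by
  have hc : Commute (TensorProduct.map (1 : Module.End ℂ V) D)
      (TensorProduct.map D (1 : Module.End ℂ V)) := by
    rw [Commute, SemiconjBy, ← TensorProduct.map_mul, ← TensorProduct.map_mul]
    simp
  let T : Module.End ℂ (V ⊗[ℂ] V) := TensorProduct.map 1 D + TensorProduct.map D 1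
  have hT : ∀ t : V ⊗[ℂ] V, D (LinearMap.mul' ℂ V t) = LinearMap.mul' ℂ V (T t) := by
    intro t
    induction t with
    | zero => simp
    | tmul u v => simp [hD, T]
    | add x y hx hy => simp only [map_add, hx, hy]
  have e : ∀ (l : ℕ) (t : V ⊗[ℂ] V), (D ^ l) (LinearMap.mul' ℂ V t)
      = LinearMap.mul' ℂ V ((T ^ l) t) := by
    intro l
    induction l with
    | zero => simp
    | succ l ih => intro t; rw [pow_succ, pow_succ, Module.End.mul_apply, hT, ih]; rfl
  rw [← LinearMap.mul'_apply (R := ℂ) (a := x), e, hc.add_pow', LinearMap.sum_apply, map_sum]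
  refine Finset.sum_eq_zero fun p hp => ?_
  rw [Finset.HasAntidiagonal.mem_antidiagonal] at hp
  rw [TensorProduct.map_pow, TensorProduct.map_pow, ← TensorProduct.map_mul]
  simp only [one_pow, mul_one, one_mul, LinearMap.smul_apply, TensorProduct.map_tmul]
  rcases le_or_gt n p.2 with h | h
  · rw [pow_apply_eq_zero_of_le h hx]; simp
  · rw [pow_apply_eq_zero_of_le (show n ≤ p.1 by omega) hy]; simp

theorem braidedMul_assoc (u v w : X.carrier ⊗[ℂ] Y.carrier) :
    braidedMul X Y (braidedMul X Y (u ⊗ₜ v) ⊗ₜ w)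
      = braidedMul X Y (u ⊗ₜ braidedMul X Y (v ⊗ₜ w)) := by
  induction u with
  | zero => simp
  | add u₁ u₂ h₁ h₂ => simp only [TensorProduct.add_tmul, map_add, h₁, h₂]
  | tmul a b =>
  induction v with
  | zero => simp
  | add u₁ u₂ h₁ h₂ => simp only [TensorProduct.add_tmul, TensorProduct.tmul_add, map_add, h₁, h₂]
  | tmul c d =>
  induction w with
  | zero => simp
  | add u₁ u₂ h₁ h₂ => simp only [TensorProduct.tmul_add, map_add, h₁, h₂]
  | tmul e f =>
  obtain ⟨m₁, hm₁⟩ := Y.act_A_locNil b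
  obtain ⟨m₂, hm₂⟩ := Y.act_A_locNil d
  set n := max m₁ m₂
  have hb : (Y.act (Uq.A ω) ^ n) b = 0 := pow_apply_eq_zero_of_le (le_max_left _ _) hm₁
  have hd : (Y.act (Uq.A ω) ^ n) d = 0 := pow_apply_eq_zero_of_le (le_max_right _ _) hm₂
  set D := Y.act (Uq.A ω) with hD
  set E := X.act (Uq.Ad ω) with hE
  let c' : ℕ → ℂ := fun k => ω ^ k * (k.factorial : ℂ)⁻¹
  have hzero : ∀ k, n ≤ k → (D ^ k) b = 0 := fun k hk => pow_apply_eq_zero_of_le hk hb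
  have hzero' : ∀ k, n ≤ k → (D ^ k) d = 0 := fun k hk => pow_apply_eq_zero_of_le hk hd
  -- the common value of both sides
  let F : ℕ → ℕ → ℕ → X.carrier ⊗[ℂ] Y.carrier := fun k p q =>
    (c' k * (c' p * c' q)) • ((a * (E ^ k) c * (E ^ (p + q)) e) ⊗ₜ[ℂ]
      ((D ^ (p + k)) b * (D ^ q) d * f))
  have hL : braidedMul X Y (braidedMul X Y ((a ⊗ₜ b) ⊗ₜ (c ⊗ₜ d)) ⊗ₜ (e ⊗ₜ f))
      = ∑ k ∈ Finset.range n, ∑ p ∈ Finset.range n, ∑ q ∈ Finset.range n, F k p q := by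
    rw [braidedMul_tmul_eq_sum X Y a c d hb, TensorProduct.sum_tmul, map_sum]
    refine Finset.sum_congr rfl fun k _ => ?_
    have hk : (D ^ n) ((D ^ k) b) = 0 := by
      rw [← Module.End.mul_apply, ← pow_add]; exact hzero _ (by omega)
    rw [← TensorProduct.smul_tmul', map_smul,
      braidedMul_tmul_eq_sum X Y _ e f (pow_mul_eq_zero (act_leibniz Y (tensorAct_A Y Y)) hk hd), Finset.smul_sum,
      ← sum_antidiagonal_eq (F k) (fun p q hp => by simp [F, hzero (p + k) (by omega)])
        (fun p q hq => by simp [F, hzero' q hq])]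
    refine Finset.sum_congr rfl fun l _ => ?_
    rw [← TensorProduct.tmul_smul, ← smul_mul_assoc, pow_leibniz Y (tensorAct_A Y Y),
      Finset.sum_mul, TensorProduct.tmul_sum, Finset.smul_sum]
    refine Finset.sum_congr rfl fun p hp => ?_
    rw [Finset.HasAntidiagonal.mem_antidiagonal] at hp
    simp only [F]
    rw [smul_mul_assoc, TensorProduct.tmul_smul, smul_smul, hp, pow_add D,
      Module.End.mul_apply]
  have hR : braidedMul X Y ((a ⊗ₜ b) ⊗ₜ braidedMul X Y ((c ⊗ₜ d) ⊗ₜ (e ⊗ₜ f)))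
      = ∑ q ∈ Finset.range n, ∑ k ∈ Finset.range n, ∑ p ∈ Finset.range n, F k p q := by
    rw [braidedMul_tmul_eq_sum X Y c e f hd, TensorProduct.tmul_sum, map_sum]
    refine Finset.sum_congr rfl fun q _ => ?_
    rw [TensorProduct.tmul_smul, map_smul,
      braidedMul_tmul_eq_sum X Y a _ _ (hzero (2 * n) (by omega)), Finset.smul_sum,
      ← sum_antidiagonal_eq (fun k p => F k p q) (fun k p hp => by simp [F, hzero (p + k) (by omega)])
        (fun k p hq => by simp [F, hzero (p + k) (by omega)])]
    refine Finset.sum_congr rfl fun l _ => ?_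
    rw [TensorProduct.smul_tmul', ← mul_smul_comm, pow_leibniz X (tensorAct_Ad X X),
      Finset.mul_sum, TensorProduct.sum_tmul, Finset.smul_sum]
    refine Finset.sum_congr rfl fun p hp => ?_
    rw [Finset.HasAntidiagonal.mem_antidiagonal] at hp
    simp only [F]
    rw [mul_smul_comm, ← TensorProduct.smul_tmul', smul_smul, add_comm p.2 p.1, hp, pow_add E,
      Module.End.mul_apply]
    congr 1
    · simp only [c']
      ring
    · rw [mul_assoc a, mul_assoc ((D ^ l) b)]
  rw [hL, hR]
  exact (Finset.sum_congr rfl fun k _ => Finset.sum_comm).trans Finset.sum_comm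

theorem act_A_one : X.act (Uq.A ω) 1 = 0 := by
  rw [X.act_one, Uq.counit_gen]; simp [Uq.counitGen]

theorem act_Ad_one : X.act (Uq.Ad ω) 1 = 0 := by
  rw [X.act_one, Uq.counit_gen]; simp [Uq.counitGen]

theorem one_braidedMul (t : X.carrier ⊗[ℂ] Y.carrier) :
    braidedMul X Y ((1 ⊗ₜ 1) ⊗ₜ t) = t := by
  induction t with
  | zero => simp
  | add u v hu hv => rw [TensorProduct.tmul_add, map_add, hu, hv]
  | tmul c d =>
    rw [braidedMul_tmul_eq_sum X Y 1 c d (n := 1) (by simp [act_A_one])]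
    simp

theorem braidedMul_one (t : X.carrier ⊗[ℂ] Y.carrier) :
    braidedMul X Y (t ⊗ₜ (1 ⊗ₜ 1)) = t := by
  induction t with
  | zero => simp
  | add u v hu hv => rw [TensorProduct.add_tmul, map_add, hu, hv]
  | tmul a b =>
    obtain ⟨n, hn⟩ := Y.act_A_locNil b
    rw [braidedMul_tmul_eq_sum X Y a 1 1 (pow_apply_eq_zero_of_le (Nat.le_succ n) hn),
      Finset.sum_range_succ', Finset.sum_eq_zero]
    · simp
    · intro k _
      rw [pow_succ (X.act (Uq.Ad ω)), Module.End.mul_apply, act_Ad_one]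
      simp

instance : Ring (BTensor X Y) :=
  { (inferInstance : AddCommGroup (BTensor X Y)) with
    mul := fun u v => braidedMul X Y (u ⊗ₜ v)
    one := (1 : X.carrier) ⊗ₜ[ℂ] (1 : Y.carrier)
    left_distrib := fun u v w =>
      (congrArg (braidedMul X Y) (TensorProduct.tmul_add _ _ _)).trans (map_add _ _ _)
    right_distrib := fun u v w =>
      (congrArg (braidedMul X Y) (TensorProduct.add_tmul _ _ _)).trans (map_add _ _ _)
    zero_mul := fun u =>
      (congrArg (braidedMul X Y) (TensorProduct.zero_tmul _ _)).trans (map_zero _)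
    mul_zero := fun u =>
      (congrArg (braidedMul X Y) (TensorProduct.tmul_zero _ _)).trans (map_zero _)
    mul_assoc := braidedMul_assoc X Y
    one_mul := one_braidedMul X Y
    mul_one := braidedMul_one X Y }

theorem smul_braidedMul (c : ℂ) (u v : X.carrier ⊗[ℂ] Y.carrier) :
    braidedMul X Y ((c • u) ⊗ₜ v) = c • braidedMul X Y (u ⊗ₜ v) := by
  rw [← TensorProduct.smul_tmul', map_smul]

theorem braidedMul_smul (c : ℂ) (u v : X.carrier ⊗[ℂ] Y.carrier) :
    braidedMul X Y (u ⊗ₜ (c • v)) = c • braidedMul X Y (u ⊗ₜ v) := by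
  rw [TensorProduct.tmul_smul, map_smul]

instance : Algebra ℂ (BTensor X Y) :=
  Algebra.ofModule (smul_braidedMul X Y) (braidedMul_smul X Y)

/-- The action of `U_q(h)` on the braided tensor product. -/
def BTensor.act : Uq ω →ₐ[ℂ] Module.End ℂ (BTensor X Y) := tensorAct X.act Y.act

theorem BTensor.mul'_tmul (u v : BTensor X Y) :
    LinearMap.mul' ℂ (BTensor X Y) (u ⊗ₜ v) = braidedMul X Y (u ⊗ₜ v) := rfl

theorem tensorAct_one (h : Uq ω) :
    tensorAct X.act Y.act h (1 ⊗ₜ 1)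
      = Uq.counit ω h • ((1 : X.carrier) ⊗ₜ[ℂ] (1 : Y.carrier)) := by
  have hN : ∀ Z : ModAlg ω, Z.act (Uq.N ω) 1 = 0 := fun Z => by
    rw [Z.act_one, Uq.counit_gen]; simp [Uq.counitGen]
  induction h using Uq.gen_induction with
  | hg g =>
    rw [Uq.counit_gen]
    cases g
    · rw [tensorAct_A]; simp [act_A_one, Uq.counitGen]
    · rw [tensorAct_Ad]; simp [act_Ad_one, Uq.counitGen]
    · rw [tensorAct_N]; simp [hN, Uq.counitGen]
    · rw [tensorAct_H]; simp [Uq.counitGen]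
    · rw [tensorAct_gen_K]; simp [Uq.counitGen]
    · rw [tensorAct_gen_Kinv]; simp [Uq.counitGen]
  | hc c => rw [AlgHom.commutes, AlgHom.commutes]; rfl
  | ha x y hx hy => rw [map_add, map_add, LinearMap.add_apply, hx, hy, add_smul]
  | hm x y hx hy => rw [map_mul, map_mul, Module.End.mul_apply, hy, map_smul, hx, smul_smul, mul_comm]

/-- `A`, `A†` and `N` act on the braided tensor product as derivations. -/
theorem BTensor.leibniz {h : Uq ω}
    (hXY : tensorAct X.act Y.act h = TensorProduct.map 1 (Y.act h) + TensorProduct.map (X.act h) 1)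
    (hYX : tensorAct Y.act X.act h = TensorProduct.map 1 (X.act h) + TensorProduct.map (Y.act h) 1)
    (hX : tensorAct X.act X.act h = TensorProduct.map 1 (X.act h) + TensorProduct.map (X.act h) 1)
    (hY : tensorAct Y.act Y.act h = TensorProduct.map 1 (Y.act h) + TensorProduct.map (Y.act h) 1)
    (hc : Commute (tensorAct Y.act X.act h) (exponentA Y X)) (u v : X.carrier ⊗[ℂ] Y.carrier) :
    tensorAct X.act Y.act h (braidedMul X Y (u ⊗ₜ v))
      = braidedMul X Y (u ⊗ₜ tensorAct X.act Y.act h v)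
        + braidedMul X Y (tensorAct X.act Y.act h u ⊗ₜ v) := by
  induction u with
  | zero => simp
  | add u₁ u₂ h₁ h₂ => simp only [TensorProduct.add_tmul, map_add, h₁, h₂]; abel
  | tmul a b =>
  induction v with
  | zero => simp
  | add u₁ u₂ h₁ h₂ => simp only [TensorProduct.tmul_add, map_add, h₁, h₂]; abel
  | tmul c d =>
  have hb := braiding_comm Y X hc hYX hXY (b ⊗ₜ c)
  have key : ∀ t : X.carrier ⊗[ℂ] Y.carrier,
      tensorAct X.act Y.act h
          (TensorProduct.map (LinearMap.mulLeft ℂ a) (LinearMap.mulRight ℂ d) t)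
        = TensorProduct.map (LinearMap.mulLeft ℂ (X.act h a)) (LinearMap.mulRight ℂ d) t
        + TensorProduct.map (LinearMap.mulLeft ℂ a) (LinearMap.mulRight ℂ (Y.act h d)) t
        + TensorProduct.map (LinearMap.mulLeft ℂ a) (LinearMap.mulRight ℂ d)
            (tensorAct X.act Y.act h t) := by
    intro t
    induction t with
    | zero => simp
    | add u₁ u₂ h₁ h₂ => simp only [map_add, h₁, h₂]; abel
    | tmul x y =>
      simp only [hXY, LinearMap.add_apply, TensorProduct.map_tmul, Module.End.one_apply, map_add,
        LinearMap.mulLeft_apply, LinearMap.mulRight_apply, act_leibniz X hX, act_leibniz Y hY,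
        TensorProduct.tmul_add, TensorProduct.add_tmul]
      abel
  rw [braidedMul_tmul, key, ← hb]
  simp only [hXY, hYX, LinearMap.add_apply, TensorProduct.map_tmul, Module.End.one_apply,
    TensorProduct.tmul_add, TensorProduct.add_tmul, map_add, braidedMul_tmul]
  abel

theorem commute_A : Commute (tensorAct X.act Y.act (Uq.A ω)) (exponentA X Y) := by
  rw [tensorAct_A, exponentA_eq]
  refine Commute.smul_right ?_ _
  rw [Commute, SemiconjBy, add_mul, mul_add]
  simp only [← TensorProduct.map_mul, one_mul, mul_one, act_A_comm_act_Ad]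

theorem commute_Ad : Commute (tensorAct X.act Y.act (Uq.Ad ω)) (exponentA X Y) := by
  rw [tensorAct_Ad, exponentA_eq]
  refine Commute.smul_right ?_ _
  rw [Commute, SemiconjBy, add_mul, mul_add]
  simp only [← TensorProduct.map_mul, one_mul, mul_one, act_A_comm_act_Ad]

theorem commute_N : Commute (tensorAct X.act Y.act (Uq.N ω)) (exponentA X Y) := by
  rw [tensorAct_N, exponentA_eq]
  refine Commute.smul_right ?_ _
  rw [Commute, SemiconjBy, add_mul, mul_add]
  have hA : X.act (Uq.N ω) * X.act (Uq.A ω)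
      = X.act (Uq.A ω) * X.act (Uq.N ω) + (-1 : ℂ) • X.act (Uq.A ω) := by
    rw [← map_mul, Uq.N_mul_A, map_sub, map_mul]; module
  have hAd : Y.act (Uq.N ω) * Y.act (Uq.Ad ω)
      = Y.act (Uq.Ad ω) * Y.act (Uq.N ω) + Y.act (Uq.Ad ω) := by
    rw [← map_mul, Uq.N_mul_Ad, map_add, map_mul]
  simp only [← TensorProduct.map_mul, one_mul, mul_one, hA, hAd, TensorProduct.map_add_right,
    TensorProduct.map_add_left, TensorProduct.map_smul_left]
  module

/-- An action of `U_q(h)` on an algebra for which `H` acts by zero, `e^{ωH/4}` as the identity and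
`A`, `A†`, `N` as derivations makes the product a morphism of `U_q(h)`-modules. -/
theorem act_mul_of_leibniz {V : Type*} [Ring V] [Algebra ℂ V] (act : Uq ω →ₐ[ℂ] Module.End ℂ V)
    (hH : act (Uq.H ω) = 0) (hK : act (Uq.gen ω .K) = 1)
    (hA : ∀ x y, act (Uq.A ω) (x * y) = x * act (Uq.A ω) y + act (Uq.A ω) x * y)
    (hAd : ∀ x y, act (Uq.Ad ω) (x * y) = x * act (Uq.Ad ω) y + act (Uq.Ad ω) x * y)
    (hN : ∀ x y, act (Uq.N ω) (x * y) = x * act (Uq.N ω) y + act (Uq.N ω) x * y)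
    (h : Uq ω) (t : V ⊗[ℂ] V) :
    act h (LinearMap.mul' ℂ V t) = LinearMap.mul' ℂ V (tensorAct act act h t) := by
  have prim : ∀ h : Uq ω, tensorAct act act h
        = TensorProduct.map 1 (act h) + TensorProduct.map (act h) 1 →
      (∀ x y, act h (x * y) = x * act h y + act h x * y) →
      ∀ t, act h (LinearMap.mul' ℂ V t) = LinearMap.mul' ℂ V (tensorAct act act h t) := by
    intro h h₁ h₂ t
    rw [h₁]
    induction t with
    | zero => simp
    | tmul u v => simp [h₂]
    | add x y hx hy => simp only [map_add, hx, hy]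
  have hKinv : act (Uq.gen ω .Kinv) = 1 := by
    have h := congrArg act (Uq.gen_K_mul_gen_Kinv ω)
    rwa [map_mul, hK, one_mul, map_one] at h
  have hT : ∀ g, tensorAct act act (Uq.gen ω g)
      = Module.endTensorEndAlgHom (R := ℂ) (S := ℂ) (A := ℂ)
        (Algebra.TensorProduct.map act act (Uq.comulGen ω g)) := by
    intro g
    rw [← Uq.comul_gen]
    rfl
  induction h using Uq.gen_induction generalizing t with
  | hg g =>
    cases g
    · refine prim _ ?_ hA t
      rw [hT]
      simp only [Uq.comulGen, map_add, Algebra.TensorProduct.map_tmul, end_tmul, hK, hKinv]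
    · refine prim _ ?_ hAd t
      rw [hT]
      simp only [Uq.comulGen, map_add, Algebra.TensorProduct.map_tmul, end_tmul, hK, hKinv]
    · refine prim _ ?_ hN t
      rw [hT]
      simp only [Uq.comulGen, map_add, Algebra.TensorProduct.map_tmul, end_tmul, map_one]
      exact add_comm _ _
    · rw [hT, hH]
      simp only [Uq.comulGen, map_add, Algebra.TensorProduct.map_tmul, end_tmul, hH,
        TensorProduct.map_zero_left, TensorProduct.map_zero_right, add_zero, LinearMap.zero_apply,
        map_zero]
    · rw [hT, hK]
      simp only [Uq.comulGen, Algebra.TensorProduct.map_tmul, end_tmul, hK, TensorProduct.map_one,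
        Module.End.one_apply]
    · rw [hT, hKinv]
      simp only [Uq.comulGen, Algebra.TensorProduct.map_tmul, end_tmul, hKinv,
        TensorProduct.map_one, Module.End.one_apply]
  | hc c => simp only [AlgHom.commutes]; simp [Algebra.algebraMap_eq_smul_one]
  | ha x y hx hy => simp only [map_add, LinearMap.add_apply, hx, hy]
  | hm x y hx hy => simp only [map_mul, Module.End.mul_apply, hx, hy]

theorem BTensor.act_mul (h : Uq ω) (t : BTensor X Y ⊗[ℂ] BTensor X Y) :
    BTensor.act X Y h (LinearMap.mul' ℂ (BTensor X Y) t)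
      = LinearMap.mul' ℂ (BTensor X Y) (tensorAct (BTensor.act X Y) (BTensor.act X Y) h t) :=
  act_mul_of_leibniz (BTensor.act X Y) (tensorAct_H X Y) (tensorAct_gen_K X Y)
    (BTensor.leibniz X Y (tensorAct_A X Y) (tensorAct_A Y X) (tensorAct_A X X)
      (tensorAct_A Y Y) (commute_A Y X))
    (BTensor.leibniz X Y (tensorAct_Ad X Y) (tensorAct_Ad Y X) (tensorAct_Ad X X)
      (tensorAct_Ad Y Y) (commute_Ad Y X))
    (BTensor.leibniz X Y (tensorAct_N X Y) (tensorAct_N Y X) (tensorAct_N X X)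
      (tensorAct_N Y Y) (commute_N Y X)) h t

/-- The braided tensor product `X ⊗̲ Y`. -/
abbrev braidedTensor : ModAlg ω where
  carrier := BTensor X Y
  act := BTensor.act X Y
  act_one := tensorAct_one X Y
  act_mul := BTensor.act_mul X Y
  act_H := tensorAct_H X Y
  act_K := tensorAct_gen_K X Y
  act_A_locNil := by
    have h := X.act_A_locNil.sum_map Y.act_A_locNil
    rw [← tensorAct_A] at h
    exact h

variable (ω)

/-- The unit object: the ground field with the trivial action. -/
abbrev unit : ModAlg ω where
  carrier := ℂ
  act := (Algebra.lmul ℂ ℂ).comp (Uq.counit ω)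
  act_one h := by simp
  act_mul h t := act_mul_of_leibniz _ (by simp [Uq.counit_gen, Uq.counitGen])
    (by rw [AlgHom.comp_apply, Uq.counit_gen]; exact map_one _)
    (by simp [Uq.counit_gen, Uq.counitGen]) (by simp [Uq.counit_gen, Uq.counitGen])
    (by simp [Uq.counit_gen, Uq.counitGen]) h t
  act_H := by simp [Uq.counit_gen, Uq.counitGen]
  act_K := by
    rw [← Uq.gen_K, AlgHom.comp_apply, Uq.counit_gen]
    exact map_one _
  act_A_locNil := fun v => ⟨1, by simp [Uq.counit_gen, Uq.counitGen]⟩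

theorem adjoint_one (h : Uq ω) : Uq.adjoint ω h 1 = Uq.counit ω h • (1 : Uq ω) := by
  induction h using Uq.gen_induction with
  | hg g =>
    rw [Uq.counit_gen]
    cases g
    · rw [Uq.adjoint_A]; simp [Uq.counitGen]
    · rw [Uq.adjoint_Ad]; simp [Uq.counitGen]
    · rw [Uq.adjoint_N]; simp [Uq.counitGen]
    · rw [Uq.adjoint_H]; simp [Uq.counitGen]
    · rw [Uq.adjoint_K]; simp [Uq.counitGen]
    · have h := congrArg (Uq.adjoint ω) (Uq.gen_K_mul_gen_Kinv ω)
      rw [map_mul, Uq.adjoint_K, one_mul, map_one] at h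
      rw [h]; simp [Uq.counitGen]
  | hc c => rw [AlgHom.commutes, AlgHom.commutes]; rfl
  | ha x y hx hy => rw [map_add, map_add, LinearMap.add_apply, hx, hy, add_smul]
  | hm x y hx hy => rw [map_mul, map_mul, Module.End.mul_apply, hy, map_smul, hx, smul_smul, mul_comm]

theorem adjoint_A_leibniz (x y : Uq ω) : Uq.adjoint ω (Uq.A ω) (x * y)
    = x * Uq.adjoint ω (Uq.A ω) y + Uq.adjoint ω (Uq.A ω) x * y := by
  simp only [Uq.adjoint_A, Uq.gen_Kinv]
  rw [← mul_assoc x, ← Uq.Kinv_comm x]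
  noncomm_ring

theorem adjoint_Ad_leibniz (x y : Uq ω) : Uq.adjoint ω (Uq.Ad ω) (x * y)
    = x * Uq.adjoint ω (Uq.Ad ω) y + Uq.adjoint ω (Uq.Ad ω) x * y := by
  simp only [Uq.adjoint_Ad, Uq.gen_Kinv]
  rw [← mul_assoc x, ← Uq.Kinv_comm x]
  noncomm_ring

theorem adjoint_N_leibniz (x y : Uq ω) : Uq.adjoint ω (Uq.N ω) (x * y)
    = x * Uq.adjoint ω (Uq.N ω) y + Uq.adjoint ω (Uq.N ω) x * y := by
  simp only [Uq.adjoint_N]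
  noncomm_ring

theorem adjoint_A_locNil : LocNil (Uq.adjoint ω (Uq.A ω)) := by
  have hz : ∀ z : Uq ω, Uq.A ω * z = z * Uq.A ω → Uq.adjoint ω (Uq.A ω) z = 0 := by
    intro z h; rw [Uq.adjoint_A, h, sub_self, mul_zero]
  have hK : Uq.adjoint ω (Uq.A ω) (Uq.gen ω .K) = 0 := hz _ (Uq.K_comm _).symm
  have hKinv : Uq.adjoint ω (Uq.A ω) (Uq.gen ω .Kinv) = 0 := hz _ (Uq.Kinv_comm _).symm
  intro x
  induction x using Uq.gen_induction with
  | hg g =>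
    cases g
    · exact ⟨1, by rw [pow_one]; exact hz _ rfl⟩
    · refine ⟨2, ?_⟩
      rw [pow_two, Module.End.mul_apply, Uq.adjoint_A ω (Uq.Ad ω), Uq.A_mul_Ad, add_sub_cancel_left,
        Uq.brH_eq]
      simp [adjoint_A_leibniz, hK, hKinv, pow_two]
    · refine ⟨2, ?_⟩
      rw [pow_two, Module.End.mul_apply, Uq.adjoint_A ω (Uq.N ω), Uq.N_mul_A, sub_sub_cancel,
        adjoint_A_leibniz, hKinv, hz _ rfl]
      simp
    · exact ⟨1, by rw [pow_one]; exact hz _ (Uq.H_comm _).symm⟩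
    · exact ⟨1, by rw [pow_one]; exact hK⟩
    · exact ⟨1, by rw [pow_one]; exact hKinv⟩
  | hc c => exact ⟨1, by rw [pow_one]; exact hz _ (Algebra.commutes c _).symm⟩
  | ha x y hx hy =>
    obtain ⟨m, hm⟩ := hx
    obtain ⟨n, hn⟩ := hy
    exact ⟨max m n, by rw [map_add, pow_apply_eq_zero_of_le (le_max_left m n) hm,
      pow_apply_eq_zero_of_le (le_max_right m n) hn, add_zero]⟩
  | hm x y hx hy =>
    obtain ⟨m, hm⟩ := hx
    obtain ⟨n, hn⟩ := hy
    exact ⟨2 * max m n, pow_mul_eq_zero (adjoint_A_leibniz ω)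
      (pow_apply_eq_zero_of_le (le_max_left m n) hm)
      (pow_apply_eq_zero_of_le (le_max_right m n) hn)⟩

/-- `BU_q(h)`: the algebra `U_q(h)` as an algebra in the category of `U_q(h)`-modules under the
quantum adjoint action. -/
abbrev BUq : ModAlg ω where
  carrier := Uq ω
  act := Uq.adjoint ω
  act_one := adjoint_one ω
  act_mul := act_mul_of_leibniz _ (Uq.adjoint_H ω) (Uq.adjoint_K ω) (adjoint_A_leibniz ω)
    (adjoint_Ad_leibniz ω) (adjoint_N_leibniz ω)
  act_H := Uq.adjoint_H ω
  act_K := Uq.adjoint_K ω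
  act_A_locNil := adjoint_A_locNil ω

/-- The `n`-fold braided tensor product of `BU_q(h)`, obtained by iterating the braided tensor
product: the `(n+1)`-fold product is the `n`-fold one braided with one more copy of `BU_q(h)`. -/
def BUqPow : ℕ → ModAlg ω
  | 0 => unit ω
  | n + 1 => braidedTensor (BUqPow n) (BUq ω)

end ModAlg

/-- The underlying algebra of the `n`-fold braided tensor product of `BU_q(h)`. -/
abbrev BUqTensor (ω : ℂ) (n : ℕ) : Type := (ModAlg.BUqPow ω n).carrier

namespace BUqTensor

variable {ω : ℂ}

/-- The element `x₁ ⊗ ⋯ ⊗ xₙ` of the `n`-fold braided tensor product. -/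
def pureTensor : {n : ℕ} → (Fin n → Uq ω) → BUqTensor ω n
  | 0, _ => (1 : ℂ)
  | n + 1, x => (pureTensor (fun i : Fin n => x i.castSucc) ⊗ₜ[ℂ] x (Fin.last n) :
      (ModAlg.BUqPow ω n).carrier ⊗[ℂ] Uq ω)

/-- The element with `x` in the `i`-th place and `1` elsewhere. -/
def place {n : ℕ} (i : Fin n) (x : Uq ω) : BUqTensor ω n := pureTensor (Pi.mulSingle i x)

/-- The central element `e^{(ω/4) ∑ₖ mₖ H̄ₖ}`, the tensor product of the elements `e^{mₖ ωH/4}`. -/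
def expH {n : ℕ} (m : Fin n → ℤ) : BUqTensor ω n :=
  pureTensor fun k => ((Uq.K ω ^ m k : (Uq ω)ˣ) : Uq ω)

variable (ω) {n : ℕ} (i : Fin n)

/-- `X̄ᵢ = e^{-(ω/2) ∑_{k<i} H̄ₖ} Āᵢ`. -/
def X : BUqTensor ω n := expH (fun k => if k < i then -2 else 0) * place i (Uq.A ω)

/-- `X̄†ᵢ = e^{(ω/2) ∑_{k<i} H̄ₖ} Ā†ᵢ - ω [H̄ᵢ] e^{-ωH̄ᵢ/4}
∑_{j<i} e^{(ω/2) ∑_{k<j} H̄ₖ} e^{ωH̄ⱼ/4} e^{-(ω/2) ∑_{j<k<i} H̄ₖ} Ā†ⱼ`. -/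
def Xd : BUqTensor ω n :=
  expH (fun k => if k < i then 2 else 0) * place i (Uq.Ad ω)
    - ω • (place i (Uq.brH ω) * expH (Pi.single i (-1)) *
        ∑ j ∈ Finset.univ.filter (· < i),
          expH (fun k => if k < j then 2 else 0) * expH (Pi.single j 1) *
            expH (fun k => if j < k ∧ k < i then -2 else 0) * place j (Uq.Ad ω))

/-- `M̄ᵢ = N̄ᵢ - ω e^{-ωH̄ᵢ/4} ∑_{j<i} e^{-ωH̄ⱼ/4} e^{-ω ∑_{j<k<i} H̄ₖ} Ā†ⱼ Āᵢ`, which is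
`N̄ᵢ + [H̄ᵢ]⁻¹ (X̄†ᵢ X̄ᵢ - Ā†ᵢ Āᵢ)` with the division by `[H̄ᵢ]` carried out. -/
def M : BUqTensor ω n :=
  place i (Uq.N ω) - ω • (expH (Pi.single i (-1)) *
    ∑ j ∈ Finset.univ.filter (· < i),
      expH (Pi.single j (-1)) * expH (fun k => if j < k ∧ k < i then -4 else 0) *
        place j (Uq.Ad ω) * place i (Uq.A ω))

end BUqTensor

end BraidedHeisenberg

end

/-!
On modules where `H` acts by zero, the braiding is the flip composed with `exp (ω A† ⊗ A)`. The
action of `A†` on the `n`-fold braided tensor product is inner: it is the commutator with an element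
`Z`, which corresponds to `∑ⱼ e^{-(ω/2) ∑_{k<j} Hₖ} e^{-ωHⱼ/4} A†ⱼ` in the ordinary tensor power.
Hence `exp (-ω R_Z ⊗ A)`, with `R_Z` the right multiplication by `Z`, absorbs the braiding with the
next factor, and turns that factor into a copy of `U_q(h)` that centralizes the first `n` factors.
Rescaling `A` and `A†` in this copy by the central elements `e^{∓(ω/2) ∑ₖ H̄ₖ}` gives `X̄`, `X̄†`
and `M̄`, and the isomorphism follows by induction on `n`.
-/

noncomputable section

namespace BraidedHeisenberg

namespace Uq

variable {ω : ℂ}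

theorem brH_comm (x : Uq ω) : Commute (brH ω) x := by
  have hK : Commute (gen ω .K) x := K_comm x
  have hKinv : Commute (gen ω .Kinv) x := Kinv_comm x
  rw [brH_eq]
  exact ((hK.pow_left 2).sub_left (hKinv.pow_left 2)).smul_left ω⁻¹

theorem gen_Kinv_comm (x : Uq ω) : Commute (gen ω .Kinv) x := Kinv_comm x

theorem K_zpow_comm (m : ℤ) (x : Uq ω) : Commute ((K ω ^ m : (Uq ω)ˣ) : Uq ω) x :=
  Commute.units_zpow_left (K_comm x) m

theorem K_zpow_neg_one : ((K ω ^ (-1 : ℤ) : (Uq ω)ˣ) : Uq ω) = gen ω .Kinv := by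
  rw [zpow_neg_one, gen_Kinv]

theorem K_zpow_neg_four (hω : ω ≠ 0) : ((K ω ^ (-4 : ℤ) : (Uq ω)ˣ) : Uq ω)
    = 1 - ω • (gen ω .Kinv * (gen ω .Kinv * brH ω)) := by
  rw [brH, ← mul_assoc, mul_smul_comm, smul_smul, mul_inv_cancel₀ hω, one_smul, ← K_zpow_neg_one,
    mul_sub, ← Units.val_mul, ← Units.val_mul, ← Units.val_mul, ← zpow_add, ← zpow_natCast,
    ← zpow_add, ← zpow_add]
  norm_num

theorem algHom_ext {B : Type*} [Semiring B] [Algebra ℂ B] {f g : Uq ω →ₐ[ℂ] B}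
    (hA : f (A ω) = g (A ω)) (hAd : f (Ad ω) = g (Ad ω)) (hN : f (N ω) = g (N ω))
    (hH : f (H ω) = g (H ω)) (hK : f (K ω : Uq ω) = g (K ω : Uq ω)) : f = g := by
  have hKinv : f (gen ω .Kinv) = g (gen ω .Kinv) := by
    refine left_inv_eq_right_inv (a := f (gen ω .K)) ?_ ?_
    · rw [← map_mul, gen_Kinv_mul_gen_K, map_one]
    · rw [gen_K, hK, ← gen_K, ← map_mul, gen_K_mul_gen_Kinv, map_one]
  ext x
  induction x using gen_induction with
  | hg g => cases g <;> assumption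
  | hc c => rw [AlgHom.commutes, AlgHom.commutes]
  | ha x y hx hy => rw [map_add, map_add, hx, hy]
  | hm x y hx hy => rw [map_mul, map_mul, hx, hy]

theorem piTensor_algEquiv_ext {ι B : Type*} [Finite ι] [DecidableEq ι] [Semiring B]
    [Algebra ℂ B] {φ ψ : B ≃ₐ[ℂ] ⨂[ℂ] _ : ι, Uq ω}
    (h : ∀ i, ∀ x ∈ ({A ω, Ad ω, N ω, H ω, ↑(K ω)} : Set (Uq ω)),
      φ.symm (PiTensorProduct.singleAlgHom i x) = ψ.symm (PiTensorProduct.singleAlgHom i x)) :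
    φ = ψ := by
  have := Fintype.ofFinite ι
  have hsymm : (φ.symm : (⨂[ℂ] _ : ι, Uq ω) →ₐ[ℂ] B) = ψ.symm :=
    PiTensorProduct.algHom_ext fun i => by
      apply algHom_ext <;> exact h i _ (by simp)
  have hsymm' : φ.symm = ψ.symm := AlgEquiv.ext fun x => DFunLike.congr_fun hsymm x
  rw [← φ.symm_symm, hsymm', AlgEquiv.symm_symm]

theorem adjoint_A_of_commute {x : Uq ω} (hx : Commute x (A ω)) : adjoint ω (A ω) x = 0 := by
  rw [adjoint_A, hx.eq, sub_self, mul_zero]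

theorem adjoint_Ad_of_commute {x : Uq ω} (hx : Commute x (Ad ω)) :
    adjoint ω (Ad ω) x = 0 := by
  rw [adjoint_Ad, hx.eq, sub_self, mul_zero]

theorem adjoint_A_Ad : adjoint ω (A ω) (Ad ω) = gen ω .Kinv * brH ω := by
  rw [adjoint_A, A_mul_Ad, add_sub_cancel_left]

theorem adjoint_A_N : adjoint ω (A ω) (N ω) = gen ω .Kinv * A ω := by
  rw [adjoint_A, N_mul_A, sub_sub_cancel]

theorem adjoint_A_Kinv_mul_Ad :
    adjoint ω (A ω) (gen ω .Kinv * Ad ω) = gen ω .Kinv * (gen ω .Kinv * brH ω) := by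
  rw [adjoint_A, ← mul_assoc (A ω), ← (gen_Kinv_comm (A ω)).eq, mul_assoc, mul_assoc, ← mul_sub,
    A_mul_Ad, add_sub_cancel_left]

theorem Kinv_mul_brH_comm (x : Uq ω) : Commute (gen ω .Kinv * brH ω) x :=
  (gen_Kinv_comm x).mul_left (brH_comm x)

section Rescale

variable (ω) {S : Type*} [Ring S] [Algebra ℂ S] (p : Sˣ)

/-- The images of the generators under `rescale`. -/
def rescaleGen : Gen → S ⊗[ℂ] Uq ω
  | .A => (p : S) ⊗ₜ A ω
  | .Ad => ((p⁻¹ : Sˣ) : S) ⊗ₜ Ad ω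
  | g => 1 ⊗ₜ gen ω g

/-- The embedding of `U_q(h)` into `S ⊗ U_q(h)` as the right factor, with `A` rescaled by the
unit `p` of `S` and `A†` by its inverse. -/
def rescale : Uq ω →ₐ[ℂ] S ⊗[ℂ] Uq ω :=
  lift (rescaleGen ω p)
    (by simp [rescaleGen, A_mul_Ad, brH_eq, TensorProduct.tmul_add, TensorProduct.tmul_sub,
      pow_two])
    (by simp [rescaleGen, N_mul_A, TensorProduct.tmul_sub])
    (by simp [rescaleGen, N_mul_Ad, TensorProduct.tmul_add])
    (fun g => by cases g <;> simp [rescaleGen, H_comm])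
    (fun g => by cases g <;> simp [rescaleGen, gen_K, K_comm])
    (by simp [rescaleGen, gen_K_mul_gen_Kinv, Algebra.TensorProduct.one_def])
    (by simp [rescaleGen, gen_Kinv_mul_gen_K, Algebra.TensorProduct.one_def])

theorem rescale_gen (g : Gen) : rescale ω p (gen ω g) = rescaleGen ω p g :=
  lift_gen _ _ _ _ _ _ _ _ _

variable {p} in
theorem commute_tmul_one_rescale (hp : ∀ s : S, Commute ↑p s) (s : S) (x : Uq ω) :
    Commute (s ⊗ₜ[ℂ] (1 : Uq ω)) (rescale ω p x) := by
  have hs (y : Uq ω) {t : S} (ht : Commute s t) : Commute (s ⊗ₜ[ℂ] (1 : Uq ω)) (t ⊗ₜ[ℂ] y) :=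
    ht.tmul (Commute.one_left y)
  induction x using gen_induction with
  | hg g =>
    rw [rescale_gen]
    cases g
    · exact hs _ (hp s).symm
    · exact hs _ (hp s).symm.units_inv_right
    all_goals exact hs _ (Commute.one_right s)
  | hc c =>
    rw [AlgHom.commutes]
    exact (Algebra.commutes c _).symm
  | ha x y hx hy =>
    rw [map_add]
    exact hx.add_right hy
  | hm x y hx hy =>
    rw [map_mul]
    exact hx.mul_right hy

section Central

variable {p} (hp : ∀ s : S, Commute ↑p s)

/-- The `S`-linear extension of `rescale`. -/
def rescaleTensor : S ⊗[ℂ] Uq ω →ₐ[ℂ] S ⊗[ℂ] Uq ω :=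
  Algebra.TensorProduct.lift Algebra.TensorProduct.includeLeft (rescale ω p)
    (commute_tmul_one_rescale ω hp)

theorem rescaleTensor_tmul (s : S) (x : Uq ω) :
    rescaleTensor ω hp (s ⊗ₜ x) = s ⊗ₜ 1 * rescale ω p x := rfl

theorem rescaleTensor_comp {q : Sˣ} (hq : ∀ s : S, Commute ↑q s) (hpq : p * q = 1) :
    (rescaleTensor ω hp).comp (rescaleTensor ω hq) = AlgHom.id ℂ _ := by
  obtain rfl : q = p⁻¹ := eq_inv_of_mul_eq_one_right hpq
  refine Algebra.TensorProduct.ext (AlgHom.ext fun s => by simp [rescaleTensor_tmul])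
    (algHom_ext ?_ ?_ ?_ ?_ ?_) <;>
    simp [rescaleTensor_tmul, rescale_gen, rescaleGen, ← gen_K]

/-- The automorphism of `S ⊗ U_q(h)` that rescales `A` by a central unit `p` of `S`, `A†` by its
inverse, and fixes `S`, `N`, `H` and the exponentials. -/
def rescaleEquiv : S ⊗[ℂ] Uq ω ≃ₐ[ℂ] S ⊗[ℂ] Uq ω :=
  have hp' (s : S) : Commute ↑p⁻¹ s := (hp s).units_inv_left
  AlgEquiv.ofAlgHom (rescaleTensor ω hp) (rescaleTensor ω hp')
    (rescaleTensor_comp ω hp hp' (mul_inv_cancel p))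
    (rescaleTensor_comp ω hp' hp (inv_mul_cancel p))

theorem rescaleEquiv_tmul_one (s : S) : rescaleEquiv ω hp (s ⊗ₜ 1) = s ⊗ₜ 1 := by
  change rescaleTensor ω hp (s ⊗ₜ 1) = s ⊗ₜ 1
  rw [rescaleTensor_tmul, map_one, mul_one]

theorem rescaleEquiv_one_tmul_gen (g : Gen) :
    rescaleEquiv ω hp (1 ⊗ₜ gen ω g) = rescaleGen ω p g := by
  change rescaleTensor ω hp (1 ⊗ₜ gen ω g) = _
  rw [rescaleTensor_tmul, rescale_gen]
  exact one_mul _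

end Central

end Rescale

end Uq

section LocExp

variable {V W : Type*} [AddCommGroup V] [Module ℂ V] [AddCommGroup W] [Module ℂ W]

theorem inv_factorial_smul_add_pow {R : Type*} [Ring R] [Algebra ℂ R] {a b : R}
    (h : Commute a b) (l : ℕ) :
    (l.factorial : ℂ)⁻¹ • (a + b) ^ l = ∑ p ∈ Finset.HasAntidiagonal.antidiagonal l,
      ((p.1.factorial : ℂ)⁻¹ * (p.2.factorial : ℂ)⁻¹) • (a ^ p.1 * b ^ p.2) := by
  rw [h.add_pow', Finset.smul_sum]
  refine Finset.sum_congr rfl fun p hp => ?_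
  rw [Finset.HasAntidiagonal.mem_antidiagonal] at hp
  have hchoose : ((l.choose p.1 : ℕ) : ℂ) =
      l.factorial / (p.1.factorial * p.2.factorial) := by
    rw [Nat.cast_choose ℂ (hp ▸ Nat.le_add_right _ _), ← hp, Nat.add_sub_cancel_left]
  rw [← Nat.cast_smul_eq_nsmul ℂ, smul_smul, hchoose]
  congr 1
  have := Nat.cast_ne_zero (R := ℂ).2 l.factorial_ne_zero
  field_simp

theorem add_pow_two_mul_apply_eq_zero {S T : Module.End ℂ V} (h : Commute S T) {v : V} {n : ℕ}
    (hS : (S ^ n) v = 0) (hT : (T ^ n) v = 0) : ((S + T) ^ (2 * n)) v = 0 := by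
  rw [h.add_pow', LinearMap.sum_apply]
  refine Finset.sum_eq_zero fun p hp => ?_
  rw [Finset.HasAntidiagonal.mem_antidiagonal] at hp
  rw [LinearMap.smul_apply]
  rcases le_or_gt n p.2 with hn | hn
  · rw [Module.End.mul_apply, pow_apply_eq_zero_of_le hn hT, map_zero, smul_zero]
  · rw [(h.pow_pow _ _).eq, Module.End.mul_apply,
      pow_apply_eq_zero_of_le (by lia : n ≤ p.1) hS, map_zero, smul_zero]

theorem locExp_add {S T : Module.End ℂ V} (hS : LocNil S) (hT : LocNil T)
    (hST : LocNil (S + T)) (h : Commute S T) :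
    locExp (S + T) hST = locExp S hS * locExp T hT := by
  ext v
  obtain ⟨m, hm⟩ := hS v
  obtain ⟨n, hn⟩ := hT v
  set d := max m n
  have hSd : (S ^ d) v = 0 := pow_apply_eq_zero_of_le (le_max_left m n) hm
  have hTd : (T ^ d) v = 0 := pow_apply_eq_zero_of_le (le_max_right m n) hn
  have hSv {p : ℕ} (hp : d ≤ p) (q : ℕ) : (S ^ p) ((T ^ q) v) = 0 := by
    rw [← Module.End.mul_apply, (h.pow_pow p q).eq, Module.End.mul_apply,
      pow_apply_eq_zero_of_le hp hSd, map_zero]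
  let f (p q : ℕ) : V := ((p.factorial : ℂ)⁻¹ * (q.factorial : ℂ)⁻¹) • (S ^ p) ((T ^ q) v)
  have hterm (l : ℕ) : (l.factorial : ℂ)⁻¹ • ((S + T) ^ l) v
      = ∑ p ∈ Finset.HasAntidiagonal.antidiagonal l, f p.1 p.2 := by
    rw [← LinearMap.smul_apply, inv_factorial_smul_add_pow h, LinearMap.sum_apply]
    rfl
  rw [locExp_apply _ (add_pow_two_mul_apply_eq_zero h hSd hTd),
    Module.End.mul_apply, locExp_apply hT hTd, map_sum,
    Finset.sum_congr rfl fun l _ => hterm l,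
    ModAlg.sum_antidiagonal_eq f (fun p q hp => by simp only [f, hSv hp, smul_zero])
      (fun p q hq => by simp only [f, pow_apply_eq_zero_of_le hq hTd, map_zero, smul_zero]),
    Finset.sum_comm]
  refine Finset.sum_congr rfl fun q _ => ?_
  rw [map_smul, locExp_apply hS (hSv le_rfl q), Finset.smul_sum]
  exact Finset.sum_congr rfl fun p _ => by rw [smul_smul, mul_comm]

theorem LocNil.smul_map_right {T : Module.End ℂ W} (hT : LocNil T) (c : ℂ) (S : Module.End ℂ V) :
    LocNil (c • TensorProduct.map S T) :=
  LocNil.of_tmul fun v w => by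
    obtain ⟨n, hn⟩ := hT w
    exact ⟨n, by rw [smul_pow, TensorProduct.map_pow]; simp [hn]⟩

end LocExp

namespace ModAlg

variable {ω : ℂ} (X Y : ModAlg ω)

/-- The operator `exp (ω S ⊗ A)` on `X ⊗ Y`, where `A` stands for its action on `Y`. -/
def expTensorA (S : Module.End ℂ X.carrier) : Module.End ℂ (X.carrier ⊗[ℂ] Y.carrier) :=
  locExp (ω • TensorProduct.map S (Y.act (Uq.A ω))) (Y.act_A_locNil.smul_map_right ω S)

section ExpTensorA

variable {X}

theorem expTensorA_tmul (S : Module.End ℂ X.carrier) (x : X.carrier) {y : Y.carrier} {n : ℕ}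
    (hn : (Y.act (Uq.A ω) ^ n) y = 0) :
    expTensorA X Y S (x ⊗ₜ y) = ∑ k ∈ Finset.range n, (ω ^ k * (k.factorial : ℂ)⁻¹) •
      ((S ^ k) x ⊗ₜ[ℂ] (Y.act (Uq.A ω) ^ k) y) := by
  have hpow (k : ℕ) : ((ω • TensorProduct.map S (Y.act (Uq.A ω))) ^ k) (x ⊗ₜ y)
      = ω ^ k • ((S ^ k) x ⊗ₜ[ℂ] (Y.act (Uq.A ω) ^ k) y) := by
    rw [smul_pow, TensorProduct.map_pow, LinearMap.smul_apply, TensorProduct.map_tmul]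
  rw [expTensorA, locExp_apply _ (n := n) (by rw [hpow, hn, TensorProduct.tmul_zero, smul_zero])]
  exact Finset.sum_congr rfl fun k _ => by rw [hpow, smul_smul, mul_comm]

theorem expTensorA_zero : expTensorA X Y 0 = 1 :=
  locExp_eq_one _ (by rw [TensorProduct.map_zero_left, smul_zero])

theorem expTensorA_add {S T : Module.End ℂ X.carrier} (h : Commute S T) :
    expTensorA X Y (S + T) = expTensorA X Y S * expTensorA X Y T := by
  have hcomm : Commute (ω • TensorProduct.map S (Y.act (Uq.A ω)))
      (ω • TensorProduct.map T (Y.act (Uq.A ω))) := by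
    refine (Commute.smul_left ?_ ω).smul_right ω
    rw [Commute, SemiconjBy, ← TensorProduct.map_mul, ← TensorProduct.map_mul, h.eq]
  simp only [expTensorA, TensorProduct.map_add_left, smul_add]
  exact locExp_add _ _ _ hcomm

theorem map_one_expTensorA {S P : Module.End ℂ X.carrier} (h : Commute P S)
    (t : X.carrier ⊗[ℂ] Y.carrier) :
    TensorProduct.map P 1 (expTensorA X Y S t) = expTensorA X Y S (TensorProduct.map P 1 t) := by
  refine LinearMap.congr_fun (locExp_comm (P := TensorProduct.map P 1) _ ?_) t
  rw [mul_smul_comm, smul_mul_assoc, ← TensorProduct.map_mul, ← TensorProduct.map_mul, h.eq,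
    one_mul, mul_one]

/-- `exp (ω S ⊗ A)` as a linear automorphism of `X ⊗ Y`, with inverse `exp (-ω S ⊗ A)`. -/
def expTensorAEquiv (S : Module.End ℂ X.carrier) :
    (X.carrier ⊗[ℂ] Y.carrier) ≃ₗ[ℂ] X.carrier ⊗[ℂ] Y.carrier :=
  LinearEquiv.ofLinearMap (expTensorA X Y S) (expTensorA X Y (-S))
    ((expTensorA_add Y (Commute.neg_right (Commute.refl S))).symm.trans
      (by rw [add_neg_cancel, expTensorA_zero]; rfl))
    ((expTensorA_add Y (Commute.neg_left (Commute.refl S))).symm.trans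
      (by rw [neg_add_cancel, expTensorA_zero]; rfl))

end ExpTensorA

theorem expTensorA_tmul_of_act_A_eq_zero (S : Module.End ℂ X.carrier) (x : X.carrier)
    {y : Y.carrier} (hy : Y.act (Uq.A ω) y = 0) : expTensorA X Y S (x ⊗ₜ y) = x ⊗ₜ y := by
  rw [expTensorA_tmul Y S x (n := 1) (by rwa [pow_one])]
  simp

theorem expTensorA_tmul_of_apply_eq_zero {S : Module.End ℂ X.carrier} {x : X.carrier}
    (hx : S x = 0) (y : Y.carrier) : expTensorA X Y S (x ⊗ₜ y) = x ⊗ₜ y := by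
  obtain ⟨n, hn⟩ := Y.act_A_locNil y
  rw [expTensorA_tmul Y S x (pow_apply_eq_zero_of_le n.le_succ hn), Finset.sum_range_succ',
    Finset.sum_eq_zero fun k _ => by
      rw [pow_succ S, Module.End.mul_apply, hx, map_zero, TensorProduct.zero_tmul, smul_zero]]
  simp

/-- `A†` acts on `X` as the inner derivation `c ↦ [Z, c]`. -/
def ActAdEqCommutator (Z : X.carrier) : Prop := ∀ c, X.act (Uq.Ad ω) c = Z * c - c * Z

variable {X} in
theorem ActAdEqCommutator.act_Ad_self {Z : X.carrier} (hZ : X.ActAdEqCommutator Z) :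
    X.act (Uq.Ad ω) Z = 0 := (hZ Z).trans (sub_self _)

namespace BTensor

/-- The identity map from `X ⊗ Y` to the space underlying the braided tensor product. -/
def ofTensor : X.carrier ⊗[ℂ] Y.carrier ≃ₗ[ℂ] BTensor X Y :=
  LinearEquiv.refl ℂ (X.carrier ⊗[ℂ] Y.carrier)

theorem ofTensor_tmul_mul (a c : X.carrier) (b d : Y.carrier) :
    ofTensor X Y (a ⊗ₜ b) * ofTensor X Y (c ⊗ₜ d)
      = ofTensor X Y (TensorProduct.map (LinearMap.mulLeft ℂ a) (LinearMap.mulRight ℂ d)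
          (expTensorA X Y (X.act (Uq.Ad ω)) (c ⊗ₜ b))) := by
  obtain ⟨n, hn⟩ := Y.act_A_locNil b
  rw [expTensorA_tmul Y _ c hn, map_sum]
  simp only [map_smul, TensorProduct.map_tmul, LinearMap.mulLeft_apply, LinearMap.mulRight_apply]
  exact braidedMul_tmul_eq_sum X Y a c d hn

/-- The inclusion `a ↦ a ⊗ 1` of the left factor. -/
def inl : X.carrier →ₐ[ℂ] BTensor X Y :=
  AlgHom.ofLinearMap ((ofTensor X Y).toLinearMap ∘ₗ (TensorProduct.mk ℂ _ _).flip 1) rfl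
    fun a c => by
      simp [ofTensor_tmul_mul, expTensorA_tmul_of_act_A_eq_zero X Y _ c (act_A_one Y)]

/-- The inclusion `b ↦ 1 ⊗ b` of the right factor. -/
def inr : Y.carrier →ₐ[ℂ] BTensor X Y :=
  AlgHom.ofLinearMap ((ofTensor X Y).toLinearMap ∘ₗ TensorProduct.mk ℂ _ _ 1) rfl
    fun b d => by
      simp [ofTensor_tmul_mul, expTensorA_tmul_of_apply_eq_zero X Y (act_Ad_one X)]

theorem inl_apply (a : X.carrier) : inl X Y a = ofTensor X Y (a ⊗ₜ 1) := rfl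

theorem inr_apply (b : Y.carrier) : inr X Y b = ofTensor X Y (1 ⊗ₜ b) := rfl

theorem inl_mul_ofTensor (a : X.carrier) (t : X.carrier ⊗[ℂ] Y.carrier) :
    inl X Y a * ofTensor X Y t
      = ofTensor X Y (TensorProduct.map (LinearMap.mulLeft ℂ a) 1 t) := by
  induction t with
  | zero => simp
  | tmul c d => simp [inl_apply, ofTensor_tmul_mul,
      expTensorA_tmul_of_act_A_eq_zero X Y _ c (act_A_one Y)]
  | add s t hs ht => simp only [map_add, mul_add, hs, ht]

theorem inl_mul_inr (a : X.carrier) (b : Y.carrier) :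
    inl X Y a * inr X Y b = ofTensor X Y (a ⊗ₜ b) := by
  simp [inr_apply, inl_mul_ofTensor]

theorem inr_mul_inl (b : Y.carrier) (c : X.carrier) :
    inr X Y b * inl X Y c = ofTensor X Y (expTensorA X Y (X.act (Uq.Ad ω)) (c ⊗ₜ b)) := by
  rw [inr_apply, inl_apply, ofTensor_tmul_mul, LinearMap.mulLeft_one, LinearMap.mulRight_one,
    TensorProduct.map_id, LinearMap.id_apply]

theorem commute_inl_inr_of_act_A_eq_zero (c : X.carrier) {b : Y.carrier}
    (hb : Y.act (Uq.A ω) b = 0) : Commute (inl X Y c) (inr X Y b) := by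
  rw [Commute, SemiconjBy, inr_mul_inl, expTensorA_tmul_of_act_A_eq_zero X Y _ c hb, inl_mul_inr]

theorem commute_inl_inr_of_act_Ad_eq_zero {c : X.carrier} (hc : X.act (Uq.Ad ω) c = 0)
    (b : Y.carrier) : Commute (inl X Y c) (inr X Y b) := by
  rw [Commute, SemiconjBy, inr_mul_inl, expTensorA_tmul_of_apply_eq_zero X Y hc, inl_mul_inr]

variable {X Y} in
theorem induction_on {P : BTensor X Y → Prop} (u : BTensor X Y)
    (inl_mul_inr : ∀ a b, P (inl X Y a * inr X Y b)) (add : ∀ u v, P u → P v → P (u + v)) :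
    P u := by
  refine TensorProduct.induction_on (motive := fun t => P (ofTensor X Y t))
    ((ofTensor X Y).symm u) ?_ (fun a b => ?_) fun s t hs ht => ?_
  · simpa using inl_mul_inr 0 0
  · exact BTensor.inl_mul_inr X Y a b ▸ inl_mul_inr a b
  · exact map_add (ofTensor X Y) s t ▸ add _ _ hs ht

/-- The operator `exp (-ω R_Z ⊗ A)`, with `R_Z` the right multiplication by `Z`, as a map from the
ordinary to the braided tensor product. If `A†` acts on `X` as `[Z, ·]`, it turns the ordinary
product into the braided one. -/
def gauge (Z : X.carrier) : X.carrier ⊗[ℂ] Y.carrier ≃ₗ[ℂ] BTensor X Y :=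
  (expTensorAEquiv Y (LinearMap.mulRight ℂ (-Z))).trans (ofTensor X Y)

/-- The restriction `y ↦ exp (-ω Z ⊗ A) (1 ⊗ y)` of `gauge` to the right factor. -/
def gaugeInr (Z : X.carrier) : Y.carrier →ₗ[ℂ] BTensor X Y :=
  (gauge X Y Z).toLinearMap ∘ₗ TensorProduct.mk ℂ _ _ 1

theorem gauge_tmul (Z c : X.carrier) (y : Y.carrier) :
    gauge X Y Z (c ⊗ₜ y) = inl X Y c * gaugeInr X Y Z y := by
  refine Eq.trans (congrArg (ofTensor X Y) ?_) (inl_mul_ofTensor X Y c _).symm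
  refine Eq.trans ?_ (map_one_expTensorA Y (LinearMap.commute_mulLeft_right c (-Z)) _).symm
  rw [TensorProduct.mk_apply, TensorProduct.map_tmul, LinearMap.mulLeft_apply, mul_one]
  rfl

theorem gaugeInr_apply_eq_sum (Z : X.carrier) {y : Y.carrier} {n : ℕ}
    (hn : (Y.act (Uq.A ω) ^ n) y = 0) :
    gaugeInr X Y Z y = ∑ k ∈ Finset.range n, (ω ^ k * (k.factorial : ℂ)⁻¹) •
      (inl X Y ((-Z) ^ k) * inr X Y ((Y.act (Uq.A ω) ^ k) y)) := by
  refine (congrArg (ofTensor X Y) (expTensorA_tmul Y _ 1 hn)).trans ?_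
  simp only [map_sum, map_smul, inl_mul_inr, LinearMap.pow_mulRight, LinearMap.mulRight_apply,
    one_mul]

theorem gaugeInr_of_act_A_eq_zero (Z : X.carrier) {y : Y.carrier}
    (hy : Y.act (Uq.A ω) y = 0) : gaugeInr X Y Z y = inr X Y y := by
  rw [gaugeInr_apply_eq_sum X Y Z (n := 1) (by rwa [pow_one])]
  simp

theorem gaugeInr_of_act_A_act_A_eq_zero (Z : X.carrier) {y : Y.carrier}
    (hy : Y.act (Uq.A ω) (Y.act (Uq.A ω) y) = 0) :
    gaugeInr X Y Z y = inr X Y y - ω • (inl X Y Z * inr X Y (Y.act (Uq.A ω) y)) := by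
  rw [gaugeInr_apply_eq_sum X Y Z (n := 2) (by rwa [pow_two])]
  simp [Finset.sum_range_succ, sub_eq_add_neg]

section Inner

variable {X} {Z : X.carrier} (hZ : X.ActAdEqCommutator Z)

include hZ

theorem gaugeInr_mul (x y : Y.carrier) :
    gaugeInr X Y Z (x * y) = gaugeInr X Y Z x * gaugeInr X Y Z y := by
  obtain ⟨m₁, hm₁⟩ := Y.act_A_locNil x
  obtain ⟨m₂, hm₂⟩ := Y.act_A_locNil y
  set n := max m₁ m₂
  have hx : (Y.act (Uq.A ω) ^ n) x = 0 := pow_apply_eq_zero_of_le (le_max_left _ _) hm₁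
  have hy : (Y.act (Uq.A ω) ^ n) y = 0 := pow_apply_eq_zero_of_le (le_max_right _ _) hm₂
  have hcomm (k : ℕ) (b : Y.carrier) : Commute (inl X Y ((-Z) ^ k)) (inr X Y b) := by
    rw [map_pow, map_neg]
    exact ((commute_inl_inr_of_act_Ad_eq_zero X Y hZ.act_Ad_self b).neg_left).pow_left k
  let term (k : ℕ) (b : Y.carrier) : BTensor X Y := (ω ^ k * (k.factorial : ℂ)⁻¹) •
    (inl X Y ((-Z) ^ k) * inr X Y ((Y.act (Uq.A ω) ^ k) b))
  have hterm (b : Y.carrier) {k : ℕ} (hk : n ≤ k) (hb : (Y.act (Uq.A ω) ^ n) b = 0) :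
      term k b = 0 := by
    simp only [term, pow_apply_eq_zero_of_le hk hb, map_zero, mul_zero, smul_zero]
  have hleibniz (l : ℕ) : term l (x * y)
      = ∑ p ∈ Finset.HasAntidiagonal.antidiagonal l, term p.1 x * term p.2 y := by
    simp only [term]
    rw [← mul_smul_comm, ← map_smul, pow_leibniz Y (tensorAct_A Y Y), map_sum, Finset.mul_sum]
    refine Finset.sum_congr rfl fun p hp => ?_
    rw [Finset.HasAntidiagonal.mem_antidiagonal] at hp
    rw [map_smul, mul_smul_comm, map_mul, smul_mul_smul_comm, ← hp, pow_add, map_mul,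
      (hcomm _ _).mul_mul_mul_comm]
  rw [gaugeInr_apply_eq_sum X Y Z
      (pow_mul_eq_zero (act_leibniz Y (tensorAct_A Y Y)) hx hy),
    Finset.sum_congr rfl fun l _ => hleibniz l,
    sum_antidiagonal_eq (fun p q => term p x * term q y)
      (fun p q hp => by rw [hterm x hp hx, zero_mul])
      (fun p q hq => by rw [hterm y hq hy, mul_zero]),
    gaugeInr_apply_eq_sum X Y Z hx, gaugeInr_apply_eq_sum X Y Z hy, Finset.sum_mul_sum]

theorem commute_inl_gaugeInr (c : X.carrier) (y : Y.carrier) :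
    Commute (inl X Y c) (gaugeInr X Y Z y) := by
  have hsum : X.act (Uq.Ad ω) + LinearMap.mulLeft ℂ (-Z) = LinearMap.mulRight ℂ (-Z) := by
    ext c
    simp [hZ c, sub_eq_add_neg]
  have hcomm : Commute (LinearMap.mulLeft ℂ (-Z)) (X.act (Uq.Ad ω)) := by
    rw [eq_sub_of_add_eq hsum]
    exact (LinearMap.commute_mulLeft_right _ _).sub_right (Commute.refl _)
  obtain ⟨n, hn⟩ := Y.act_A_locNil y
  symm
  calc gaugeInr X Y Z y * inl X Y c
      = ∑ k ∈ Finset.range n, (ω ^ k * (k.factorial : ℂ)⁻¹) • (inl X Y ((-Z) ^ k) *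
          ofTensor X Y (expTensorA X Y (X.act (Uq.Ad ω)) (c ⊗ₜ (Y.act (Uq.A ω) ^ k) y))) := by
        simp only [gaugeInr_apply_eq_sum X Y Z hn, Finset.sum_mul, smul_mul_assoc, mul_assoc,
          inr_mul_inl]
    _ = ofTensor X Y (expTensorA X Y (X.act (Uq.Ad ω))
          (expTensorA X Y (LinearMap.mulLeft ℂ (-Z)) (c ⊗ₜ y))) := by
        rw [expTensorA_tmul Y _ c hn]
        simp only [map_sum, map_smul]
        refine Finset.sum_congr rfl fun k _ => ?_
        rw [inl_mul_ofTensor, ← LinearMap.pow_mulLeft, map_one_expTensorA Y (hcomm.pow_left k)]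
        rfl
    _ = gauge X Y Z (c ⊗ₜ y) := by
        rw [← Module.End.mul_apply, ← expTensorA_add Y hcomm.symm, hsum]
        rfl
    _ = inl X Y c * gaugeInr X Y Z y := gauge_tmul X Y Z c y

/-- If `A†` acts on `X` as an inner derivation, `gauge` is an isomorphism from the ordinary to the
braided tensor product. -/
def gaugeEquiv : X.carrier ⊗[ℂ] Y.carrier ≃ₐ[ℂ] BTensor X Y :=
  Algebra.TensorProduct.algEquivOfLinearEquivTensorProduct (gauge X Y Z)
    (fun a₁ a₂ b₁ b₂ => by
      rw [gauge_tmul, gauge_tmul, gauge_tmul, map_mul, gaugeInr_mul Y hZ]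
      exact (commute_inl_gaugeInr Y hZ a₂ b₁).mul_mul_mul_comm _ _)
    (by
      rw [gauge_tmul, map_one, one_mul, gaugeInr_of_act_A_eq_zero X Y Z (act_A_one Y), map_one])

theorem gaugeEquiv_tmul (c : X.carrier) (y : Y.carrier) :
    gaugeEquiv Y hZ (c ⊗ₜ y) = inl X Y c * gaugeInr X Y Z y := gauge_tmul X Y Z c y

end Inner

section Action

variable {X Y}

theorem commute_inl_mul_inr {a : X.carrier} {b : Y.carrier} (ha : ∀ c, Commute a c)
    (hAd : X.act (Uq.Ad ω) a = 0) (hb : ∀ d, Commute b d) (hA : Y.act (Uq.A ω) b = 0)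
    (u : BTensor X Y) : Commute (inl X Y a * inr X Y b) u := by
  induction u using induction_on with
  | inl_mul_inr c d =>
    have hac : Commute (inl X Y a) (inl X Y c) := (ha c).map (inl X Y)
    have hbd : Commute (inr X Y b) (inr X Y d) := (hb d).map (inr X Y)
    have had := commute_inl_inr_of_act_Ad_eq_zero X Y hAd d
    have hcb := commute_inl_inr_of_act_A_eq_zero X Y c hA
    exact (hac.mul_right had).mul_left (hcb.symm.mul_right hbd)
  | add u v hu hv => exact hu.add_right hv

theorem act_Ad_inl (c : X.carrier) :
    (braidedTensor X Y).act (Uq.Ad ω) (inl X Y c) = inl X Y (X.act (Uq.Ad ω) c) := by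
  change tensorAct X.act Y.act (Uq.Ad ω) (c ⊗ₜ 1) = X.act (Uq.Ad ω) c ⊗ₜ[ℂ] 1
  simp [tensorAct_Ad, act_Ad_one]

theorem act_Ad_inr (y : Y.carrier) :
    (braidedTensor X Y).act (Uq.Ad ω) (inr X Y y) = inr X Y (Y.act (Uq.Ad ω) y) := by
  change tensorAct X.act Y.act (Uq.Ad ω) (1 ⊗ₜ y) = 1 ⊗ₜ[ℂ] Y.act (Uq.Ad ω) y
  simp [tensorAct_Ad, act_Ad_one]

theorem actAdEqCommutator_of_inl_inr {Z : BTensor X Y}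
    (hinl : ∀ c, inl X Y (X.act (Uq.Ad ω) c) = Z * inl X Y c - inl X Y c * Z)
    (hinr : ∀ y, inr X Y (Y.act (Uq.Ad ω) y) = Z * inr X Y y - inr X Y y * Z) :
    (braidedTensor X Y).ActAdEqCommutator Z := by
  intro u
  induction u using induction_on with
  | inl_mul_inr c y =>
    rw [act_leibniz _ (tensorAct_Ad _ _), act_Ad_inl, act_Ad_inr, hinl, hinr]
    noncomm_ring
  | add u v hu hv =>
    rw [map_add, hu, hv]
    noncomm_ring

end Action

section BUq

variable {X}

theorem gaugeInr_Ad (Z : X.carrier) : gaugeInr X (BUq ω) Z (Uq.Ad ω)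
    = inr X (BUq ω) (Uq.Ad ω)
      - ω • (inl X (BUq ω) Z * inr X (BUq ω) (Uq.gen ω .Kinv * Uq.brH ω)) := by
  rw [gaugeInr_of_act_A_act_A_eq_zero, Uq.adjoint_A_Ad]
  rw [Uq.adjoint_A_Ad]
  exact Uq.adjoint_A_of_commute (Uq.Kinv_mul_brH_comm _)

theorem gaugeInr_N (Z : X.carrier) : gaugeInr X (BUq ω) Z (Uq.N ω)
    = inr X (BUq ω) (Uq.N ω)
      - ω • (inl X (BUq ω) Z * inr X (BUq ω) (Uq.gen ω .Kinv * Uq.A ω)) := by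
  rw [gaugeInr_of_act_A_act_A_eq_zero, Uq.adjoint_A_N]
  rw [Uq.adjoint_A_N]
  exact Uq.adjoint_A_of_commute ((Uq.gen_Kinv_comm _).mul_left (Commute.refl _))

theorem gaugeInr_of_commute_A (Z : X.carrier) {x : Uq ω} (hx : Commute x (Uq.A ω)) :
    gaugeInr X (BUq ω) Z x = inr X (BUq ω) x :=
  gaugeInr_of_act_A_eq_zero X (BUq ω) Z (Uq.adjoint_A_of_commute hx)

theorem gaugeInr_Kinv_mul_Ad (hω : ω ≠ 0) (Z : X.carrier) :
    inl X (BUq ω) Z + gaugeInr X (BUq ω) Z (Uq.gen ω .Kinv * Uq.Ad ω)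
      = inl X (BUq ω) Z * inr X (BUq ω) ((Uq.K ω ^ (-4 : ℤ) : (Uq ω)ˣ) : Uq ω)
        + inr X (BUq ω) (Uq.gen ω .Kinv * Uq.Ad ω) := by
  rw [gaugeInr_of_act_A_act_A_eq_zero, Uq.adjoint_A_Kinv_mul_Ad, Uq.K_zpow_neg_four hω, map_sub,
    map_one, map_smul, mul_sub, mul_one, mul_smul_comm, sub_add_eq_add_sub, add_sub_assoc]
  rw [Uq.adjoint_A_Kinv_mul_Ad]
  exact Uq.adjoint_A_of_commute ((Uq.gen_Kinv_comm _).mul_left (Uq.Kinv_mul_brH_comm _))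

theorem inr_brH_mul_gaugeInr_N_sub (Z : X.carrier) :
    inr X (BUq ω) (Uq.brH ω) * (gaugeInr X (BUq ω) Z (Uq.N ω) - inr X (BUq ω) (Uq.N ω))
      = gaugeInr X (BUq ω) Z (Uq.Ad ω) * inr X (BUq ω) (Uq.A ω)
        - inr X (BUq ω) (Uq.Ad ω) * inr X (BUq ω) (Uq.A ω) := by
  have hbrH : Commute (inl X (BUq ω) Z) (inr X (BUq ω) (Uq.brH ω)) :=
    commute_inl_inr_of_act_A_eq_zero X (BUq ω) Z (Uq.adjoint_A_of_commute (Uq.brH_comm _))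
  rw [gaugeInr_N, gaugeInr_Ad, sub_sub_cancel_left, sub_mul, sub_sub_cancel_left, mul_neg,
    mul_smul_comm, smul_mul_assoc, ← mul_assoc, ← hbrH.eq, mul_assoc, mul_assoc, ← map_mul,
    ← map_mul, ← mul_assoc, (Uq.brH_comm _).eq]

section Inner

variable {Z : X.carrier} (hZ : X.ActAdEqCommutator Z)

include hZ

theorem actAdEqCommutator_inl_add_gaugeInr (hω : ω ≠ 0) :
    (braidedTensor X (BUq ω)).ActAdEqCommutator
      (inl X (BUq ω) Z + gaugeInr X (BUq ω) Z (Uq.gen ω .Kinv * Uq.Ad ω)) := by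
  refine actAdEqCommutator_of_inl_inr (fun c => ?_) fun x => ?_
  · rw [add_mul, mul_add, (commute_inl_gaugeInr (BUq ω) hZ c _).eq, add_sub_add_right_eq_sub, hZ,
      map_sub, map_mul, map_mul]
  · have hZx : Commute (inl X (BUq ω) Z * inr X (BUq ω) ((Uq.K ω ^ (-4 : ℤ) : (Uq ω)ˣ) : Uq ω))
        (inr X (BUq ω) x) :=
      (commute_inl_inr_of_act_Ad_eq_zero X (BUq ω) hZ.act_Ad_self x).mul_left
        ((Uq.K_zpow_comm (-4) x).map (inr X (BUq ω)))
    rw [gaugeInr_Kinv_mul_Ad hω, add_mul, mul_add, hZx.eq, add_sub_add_left_eq_sub, ← map_mul,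
      ← map_mul, ← map_sub, Uq.adjoint_Ad, mul_sub, mul_assoc, ← mul_assoc x,
      (Uq.gen_Kinv_comm x).symm.eq, mul_assoc]

variable {p : X.carrierˣ} (hp : ∀ c : X.carrier, Commute ↑p c)

/-- The isomorphism `gaugeEquiv`, preceded by the rescaling of `A` and `A†` by `p` and `p⁻¹`. -/
def rescaledGaugeEquiv : X.carrier ⊗[ℂ] Uq ω ≃ₐ[ℂ] BTensor X (BUq ω) :=
  (Uq.rescaleEquiv ω hp).trans (gaugeEquiv (BUq ω) hZ)

theorem rescaledGaugeEquiv_tmul_one (c : X.carrier) :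
    rescaledGaugeEquiv hZ hp (c ⊗ₜ 1) = inl X (BUq ω) c := by
  rw [rescaledGaugeEquiv, AlgEquiv.trans_apply, Uq.rescaleEquiv_tmul_one]
  refine (gaugeEquiv_tmul (BUq ω) hZ c 1).trans ?_
  rw [gaugeInr_of_commute_A Z (Commute.one_left _), map_one, mul_one]

theorem rescaledGaugeEquiv_one_tmul_A : rescaledGaugeEquiv hZ hp (1 ⊗ₜ Uq.A ω)
    = inl X (BUq ω) p * inr X (BUq ω) (Uq.A ω) := by
  rw [rescaledGaugeEquiv, AlgEquiv.trans_apply, Uq.rescaleEquiv_one_tmul_gen]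
  refine (gaugeEquiv_tmul (BUq ω) hZ (p : X.carrier) (Uq.A ω)).trans ?_
  rw [gaugeInr_of_commute_A Z (Commute.refl _)]

theorem rescaledGaugeEquiv_one_tmul_Ad : rescaledGaugeEquiv hZ hp (1 ⊗ₜ Uq.Ad ω)
    = inl X (BUq ω) ↑p⁻¹ * gaugeInr X (BUq ω) Z (Uq.Ad ω) := by
  rw [rescaledGaugeEquiv, AlgEquiv.trans_apply, Uq.rescaleEquiv_one_tmul_gen]
  exact gaugeEquiv_tmul (BUq ω) hZ (↑p⁻¹ : X.carrier) (Uq.Ad ω)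

theorem rescaledGaugeEquiv_one_tmul_N : rescaledGaugeEquiv hZ hp (1 ⊗ₜ Uq.N ω)
    = gaugeInr X (BUq ω) Z (Uq.N ω) := by
  rw [rescaledGaugeEquiv, AlgEquiv.trans_apply, Uq.rescaleEquiv_one_tmul_gen]
  refine (gaugeEquiv_tmul (BUq ω) hZ 1 (Uq.N ω)).trans ?_
  rw [map_one, one_mul]

theorem rescaledGaugeEquiv_one_tmul_H :
    rescaledGaugeEquiv hZ hp (1 ⊗ₜ Uq.H ω) = inr X (BUq ω) (Uq.H ω) := by
  rw [rescaledGaugeEquiv, AlgEquiv.trans_apply, Uq.rescaleEquiv_one_tmul_gen]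
  refine (gaugeEquiv_tmul (BUq ω) hZ 1 (Uq.H ω)).trans ?_
  rw [map_one, one_mul, gaugeInr_of_commute_A Z (Uq.H_comm _)]

theorem rescaledGaugeEquiv_one_tmul_K :
    rescaledGaugeEquiv hZ hp (1 ⊗ₜ (Uq.K ω : Uq ω)) = inr X (BUq ω) (Uq.K ω : Uq ω) := by
  rw [rescaledGaugeEquiv, AlgEquiv.trans_apply, ← Uq.gen_K, Uq.rescaleEquiv_one_tmul_gen]
  refine (gaugeEquiv_tmul (BUq ω) hZ 1 (Uq.K ω : Uq ω)).trans ?_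
  rw [map_one, one_mul, gaugeInr_of_commute_A Z (Uq.K_comm _)]
  rfl

theorem inr_brH_mul_rescaledGaugeEquiv_N_sub :
    inr X (BUq ω) (Uq.brH ω)
        * (rescaledGaugeEquiv hZ hp (1 ⊗ₜ Uq.N ω) - inr X (BUq ω) (Uq.N ω))
      = rescaledGaugeEquiv hZ hp (1 ⊗ₜ Uq.Ad ω) * rescaledGaugeEquiv hZ hp (1 ⊗ₜ Uq.A ω)
        - inr X (BUq ω) (Uq.Ad ω) * inr X (BUq ω) (Uq.A ω) := by
  have hcomm := (commute_inl_gaugeInr (BUq ω) hZ ↑p⁻¹ (Uq.Ad ω)).eq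
  rw [rescaledGaugeEquiv_one_tmul_N, rescaledGaugeEquiv_one_tmul_Ad,
    rescaledGaugeEquiv_one_tmul_A, hcomm, mul_assoc, ← mul_assoc (inl X (BUq ω) _), ← map_mul,
    Units.inv_mul, map_one, one_mul, inr_brH_mul_gaugeInr_N_sub]

end Inner

end BUq

end BTensor

end ModAlg

section PiTensor

open PiTensorProduct

/-- The tensor product of an empty family of algebras is the ground ring. -/
def emptyPiTensorEquiv (R : Type*) {ι : Type*} [IsEmpty ι] (A : ι → Type*) [CommSemiring R]
    [∀ i, Semiring (A i)] [∀ i, Algebra R (A i)] : R ≃ₐ[R] ⨂[R] i, A i :=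
  AlgEquiv.ofBijective (Algebra.ofId R _) <| by
    have h : ⇑(Algebra.ofId R (⨂[R] i, A i)) = (isEmptyEquiv ι).symm := by
      ext r
      rw [Algebra.ofId_apply, Algebra.algebraMap_eq_smul_one, one_def]
      exact congrArg (r • PiTensorProduct.tprod R ·) (Subsingleton.elim _ _)
    exact h ▸ (isEmptyEquiv ι).symm.bijective

theorem finSnoc_mul {M : Type*} [Mul M] {n : ℕ} (a b : Fin n → M) (x y : M) :
    (Fin.snoc (a * b) (x * y) : Fin (n + 1) → M)
      = (Fin.snoc a x : Fin (n + 1) → M) * (Fin.snoc b y : Fin (n + 1) → M) := by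
  ext i
  induction i using Fin.lastCases <;> simp

variable (R A : Type*) [CommSemiring R] [Semiring A] [Algebra R A] (n : ℕ)

/-- Appending one factor to a tensor power, as a linear equivalence. -/
def snocLinearEquiv : (⨂[R] _ : Fin n, A) ⊗[R] A ≃ₗ[R] ⨂[R] _ : Fin (n + 1), A :=
  (TensorProduct.congr (LinearEquiv.refl R _)
    (subsingletonEquiv (R := R) (s := fun _ : Fin 1 => A) 0).symm).trans TensorPower.mulEquiv

theorem snocLinearEquiv_tprod_tmul (a : Fin n → A) (b : A) :
    snocLinearEquiv R A n (tprod R a ⊗ₜ[R] b) = tprod R (Fin.snoc a b : Fin (n + 1) → A) := by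
  have h : (subsingletonEquiv (R := R) (s := fun _ : Fin 1 => A) 0).symm b
      = PiTensorProduct.tprod R fun _ => b := subsingletonEquiv_symm_apply' 0 b
  rw [← Fin.append_right_eq_snoc a fun _ => b, ← TensorPower.tprod_mul_tprod, TensorPower.gMul_def,
    ← h]
  rfl

/-- Appending one factor to a tensor power, as an algebra equivalence. -/
def snocAlgEquiv : (⨂[R] _ : Fin n, A) ⊗[R] A ≃ₐ[R] ⨂[R] _ : Fin (n + 1), A :=
  Algebra.TensorProduct.algEquivOfLinearEquivTensorProduct (snocLinearEquiv R A n)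
    (by
      intro s t x y
      induction s using PiTensorProduct.induction_on with
      | smul_tprod r a =>
        induction t using PiTensorProduct.induction_on with
        | smul_tprod r' b =>
          simp only [smul_mul_assoc, mul_smul_comm, ← TensorProduct.smul_tmul', map_smul,
            tprod_mul_tprod, snocLinearEquiv_tprod_tmul, finSnoc_mul]
        | add t t' ht ht' => simp only [mul_add, TensorProduct.add_tmul, map_add, ht, ht']
      | add s s' hs hs' => simp only [add_mul, TensorProduct.add_tmul, map_add, hs, hs'])
    (by
      rw [one_def, one_def, snocLinearEquiv_tprod_tmul]
      congr 1
      ext i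
      induction i using Fin.lastCases <;> simp)

theorem snocAlgEquiv_tprod_tmul (a : Fin n → A) (b : A) :
    snocAlgEquiv R A n (tprod R a ⊗ₜ b) = tprod R (Fin.snoc a b : Fin (n + 1) → A) :=
  snocLinearEquiv_tprod_tmul R A n a b

theorem snocAlgEquiv_singleAlgHom_tmul_one (i : Fin n) (x : A) :
    snocAlgEquiv R A n (singleAlgHom (A := fun _ : Fin n => A) i x ⊗ₜ 1)
      = singleAlgHom (A := fun _ : Fin (n + 1) => A) i.castSucc x := by
  rw [singleAlgHom_apply, snocAlgEquiv_tprod_tmul, singleAlgHom_apply]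
  congr 1
  ext j
  induction j using Fin.lastCases with
  | last => simp [(Fin.castSucc_lt_last i).ne']
  | cast j => simp [Pi.mulSingle_apply]

theorem snocAlgEquiv_one_tmul (x : A) :
    snocAlgEquiv R A n (1 ⊗ₜ x)
      = singleAlgHom (A := fun _ : Fin (n + 1) => A) (Fin.last n) x := by
  rw [one_def, snocAlgEquiv_tprod_tmul, singleAlgHom_apply]
  congr 1
  ext j
  induction j using Fin.lastCases with
  | last => simp
  | cast j => simp [(Fin.castSucc_lt_last j).ne]

end PiTensor

theorem sum_filter_lt_castSucc {V : Type*} [AddCommMonoid V] {n : ℕ} (f : Fin (n + 1) → V)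
    (i : Fin n) :
    ∑ j ∈ Finset.univ.filter (· < i.castSucc), f j
      = ∑ j ∈ Finset.univ.filter (· < i), f j.castSucc := by
  simp [Finset.sum_filter, Fin.sum_univ_castSucc, (Fin.le_last _).not_gt]

theorem sum_filter_lt_last {V : Type*} [AddCommMonoid V] {n : ℕ} (f : Fin (n + 1) → V) :
    ∑ j ∈ Finset.univ.filter (· < Fin.last n), f j = ∑ j : Fin n, f j.castSucc := by
  simp [Finset.sum_filter, Fin.sum_univ_castSucc, Fin.castSucc_lt_last]

namespace BUqTensor

open ModAlg ModAlg.BTensor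

variable {ω : ℂ} {n : ℕ}

/-- The inclusion of the first `n` factors. -/
def inl : BUqTensor ω n →ₐ[ℂ] BUqTensor ω (n + 1) := BTensor.inl (BUqPow ω n) (BUq ω)

/-- The inclusion of the last factor. -/
def inr : Uq ω →ₐ[ℂ] BUqTensor ω (n + 1) := BTensor.inr (BUqPow ω n) (BUq ω)

theorem commute_inl_inr (c : BUqTensor ω n) {x : Uq ω} (hx : ∀ y, Commute x y) :
    Commute (inl c) (inr x) :=
  commute_inl_inr_of_act_A_eq_zero (BUqPow ω n) (BUq ω) c (Uq.adjoint_A_of_commute (hx _))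

theorem pureTensor_succ (x : Fin (n + 1) → Uq ω) :
    pureTensor x = inl (pureTensor fun i => x i.castSucc) * inr (x (Fin.last n)) :=
  (BTensor.inl_mul_inr (BUqPow ω n) (BUq ω) _ _).symm

theorem pureTensor_one : pureTensor (1 : Fin n → Uq ω) = 1 := by
  induction n with
  | zero => rfl
  | succ n ih =>
    rw [pureTensor_succ, Pi.one_apply, map_one, mul_one, ← map_one inl, ← ih]
    rfl

theorem place_castSucc (i : Fin n) (x : Uq ω) : place i.castSucc x = inl (place i x) := by
  have h : (fun j : Fin n => Pi.mulSingle (M := fun _ => Uq ω) i.castSucc x j.castSucc)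
      = Pi.mulSingle i x := by
    ext j
    simp [Pi.mulSingle_apply]
  rw [place, pureTensor_succ, h, Pi.mulSingle_eq_of_ne (Fin.castSucc_lt_last i).ne', map_one,
    mul_one, place]

theorem place_last (x : Uq ω) : place (Fin.last n) x = inr x := by
  have h : (fun i : Fin n => Pi.mulSingle (M := fun _ => Uq ω) (Fin.last n) x i.castSucc) = 1 := by
    ext i
    rw [Pi.mulSingle_eq_of_ne (Fin.castSucc_lt_last i).ne, Pi.one_apply]
  rw [place, pureTensor_succ, h, pureTensor_one, map_one, one_mul, Pi.mulSingle_eq_same]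

theorem expH_succ (m : Fin (n + 1) → ℤ) : expH m
    = inl (expH fun i => m i.castSucc) * inr ((Uq.K ω ^ m (Fin.last n) : (Uq ω)ˣ) : Uq ω) :=
  pureTensor_succ _

theorem expH_zero : expH (0 : Fin n → ℤ) = (1 : BUqTensor ω n) := by
  rw [← pureTensor_one, expH]
  congr 1
  ext i
  rw [Pi.zero_apply, zpow_zero, Units.val_one, Pi.one_apply]

theorem expH_eq_inl {m : Fin (n + 1) → ℤ} {m' : Fin n → ℤ} (h : ∀ i, m i.castSucc = m' i)
    (hlast : m (Fin.last n) = 0) : expH m = inl (expH (ω := ω) m') := by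
  rw [expH_succ, hlast, zpow_zero, Units.val_one, map_one, mul_one, funext h]

theorem expH_single_castSucc (i : Fin n) (k : ℤ) :
    expH (Pi.single i.castSucc k) = inl (expH (ω := ω) (Pi.single i k)) :=
  expH_eq_inl (by simp [Pi.single_apply]) (Pi.single_eq_of_ne (Fin.castSucc_lt_last i).ne' _)

theorem expH_single_last (k : ℤ) : expH (Pi.single (Fin.last n) k)
    = inr ((Uq.K ω ^ k : (Uq ω)ˣ) : Uq ω) := by
  have h : (fun i : Fin n => Pi.single (M := fun _ => ℤ) (Fin.last n) k i.castSucc) = 0 := by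
    ext i
    rw [Pi.single_eq_of_ne (Fin.castSucc_lt_last i).ne, Pi.zero_apply]
  rw [expH_succ, Pi.single_eq_same, h, expH_zero, map_one, one_mul]

theorem expH_add (m m' : Fin n → ℤ) :
    (expH (m + m') : BUqTensor ω n) = expH m * expH m' := by
  induction n with
  | zero => exact (one_mul (1 : ℂ)).symm
  | succ n ih =>
    have h := ih (fun i => m i.castSucc) (fun i => m' i.castSucc)
    rw [expH_succ, expH_succ m, expH_succ m',
      (commute_inl_inr _ (Uq.K_zpow_comm _)).symm.mul_mul_mul_comm, ← map_mul, ← map_mul,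
      ← Units.val_mul, ← zpow_add, ← h]
    rfl

theorem act_Ad_expH (m : Fin n → ℤ) : (BUqPow ω n).act (Uq.Ad ω) (expH m) = 0 := by
  induction n with
  | zero =>
    refine (congrArg (· • (1 : ℂ)) (Uq.counit_gen ω .Ad)).trans (zero_smul ℂ _)
  | succ n ih =>
    have hinl : (BUqPow ω (n + 1)).act (Uq.Ad ω) (inl (expH fun i => m i.castSucc)) = 0 :=
      (act_Ad_inl _).trans ((congrArg inl (ih _)).trans (map_zero inl))
    have hinr : (BUqPow ω (n + 1)).act (Uq.Ad ω)
        (inr ((Uq.K ω ^ m (Fin.last n) : (Uq ω)ˣ) : Uq ω)) = 0 :=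
      (act_Ad_inr _).trans ((congrArg inr
        (Uq.adjoint_Ad_of_commute (Uq.K_zpow_comm _ _))).trans (map_zero inr))
    rw [expH_succ, act_leibniz _ (tensorAct_Ad _ _), hinl, hinr, mul_zero, zero_mul, add_zero]

theorem commute_expH (m : Fin n → ℤ) (c : BUqTensor ω n) : Commute (expH m) c := by
  induction n with
  | zero => exact mul_comm (G := ℂ) _ c
  | succ n ih =>
    rw [expH_succ]
    exact commute_inl_mul_inr (ih _) (act_Ad_expH _) (Uq.K_zpow_comm _)
      (Uq.adjoint_A_of_commute (Uq.K_zpow_comm _ _)) c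

/-- The central unit `e^{(ω/4) ∑ₖ mₖ H̄ₖ}`. -/
def expHUnit (m : Fin n → ℤ) : (BUqTensor ω n)ˣ where
  val := expH m
  inv := expH (-m)
  val_inv := by rw [← expH_add, add_neg_cancel, expH_zero]
  inv_val := by rw [← expH_add, neg_add_cancel, expH_zero]

variable (ω n) in
/-- The element `∑ⱼ e^{-ωH̄ⱼ/4} e^{-ω ∑_{k>j} H̄ₖ} Ā†ⱼ`, whose commutator is the action of `A†`. -/
def innerAd : BUqTensor ω n :=
  ∑ j, expH (Pi.single j (-1)) * expH (fun k => if j < k then -4 else 0) * place j (Uq.Ad ω)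

theorem innerAd_succ : innerAd ω (n + 1)
    = inl (innerAd ω n) * inr ((Uq.K ω ^ (-4 : ℤ) : (Uq ω)ˣ) : Uq ω)
      + inr (Uq.gen ω .Kinv * Uq.Ad ω) := by
  have hlast : (fun k => if Fin.last n < k then -4 else 0) = (0 : Fin (n + 1) → ℤ) := by
    ext k
    simp [(Fin.le_last k).not_gt]
  rw [innerAd, Fin.sum_univ_castSucc, hlast, expH_zero, mul_one, expH_single_last, place_last,
    ← map_mul, Uq.K_zpow_neg_one, innerAd, map_sum, Finset.sum_mul]
  refine congrArg (· + _) (Finset.sum_congr rfl fun j _ => ?_)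
  rw [expH_single_castSucc, expH_succ]
  simp only [Fin.castSucc_lt_castSucc_iff, Fin.castSucc_lt_last, if_true]
  rw [place_castSucc, mul_assoc, mul_assoc,
    ← (commute_inl_inr (place j (Uq.Ad ω)) (Uq.K_zpow_comm (-4))).eq, ← mul_assoc, ← mul_assoc,
    ← map_mul, ← map_mul]

theorem actAdEqCommutator_innerAd (hω : ω ≠ 0) (n : ℕ) :
    (BUqPow ω n).ActAdEqCommutator (innerAd ω n) := by
  induction n with
  | zero =>
    intro c
    refine (congrArg (· • c) (Uq.counit_gen ω .Ad)).trans ?_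
    simp [Uq.counitGen, innerAd]
  | succ n ih =>
    rw [innerAd_succ]
    have h := actAdEqCommutator_inl_add_gaugeInr ih hω
    rw [gaugeInr_Kinv_mul_Ad hω] at h
    exact h

/-- Appending the last braided factor, untwisted to an ordinary tensor factor: the first `n` factors
are included unchanged, and the new copy of `U_q(h)` centralizes them. -/
def braidedSnocEquiv (hω : ω ≠ 0) (n : ℕ) :
    BUqTensor ω n ⊗[ℂ] Uq ω ≃ₐ[ℂ] BUqTensor ω (n + 1) :=
  rescaledGaugeEquiv (actAdEqCommutator_innerAd hω n) (p := expHUnit fun _ => -2) (commute_expH _)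

theorem braidedSnocEquiv_tmul_one (hω : ω ≠ 0) (c : BUqTensor ω n) :
    braidedSnocEquiv hω n (c ⊗ₜ 1) = inl c :=
  rescaledGaugeEquiv_tmul_one _ _ c

theorem braidedSnocEquiv_one_tmul_A (hω : ω ≠ 0) :
    braidedSnocEquiv hω n (1 ⊗ₜ Uq.A ω) = inl (expH fun _ => -2) * inr (Uq.A ω) :=
  rescaledGaugeEquiv_one_tmul_A _ _

theorem braidedSnocEquiv_one_tmul_Ad (hω : ω ≠ 0) : braidedSnocEquiv hω n (1 ⊗ₜ Uq.Ad ω)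
    = inl (expH fun _ => 2)
      * (inr (Uq.Ad ω) - ω • (inl (innerAd ω n) * inr (Uq.gen ω .Kinv * Uq.brH ω))) :=
  (rescaledGaugeEquiv_one_tmul_Ad _ _).trans
    (congrArg (inl (expH fun _ => 2) * ·) (gaugeInr_Ad (innerAd ω n)))

theorem braidedSnocEquiv_one_tmul_N (hω : ω ≠ 0) : braidedSnocEquiv hω n (1 ⊗ₜ Uq.N ω)
    = inr (Uq.N ω) - ω • (inl (innerAd ω n) * inr (Uq.gen ω .Kinv * Uq.A ω)) :=
  (rescaledGaugeEquiv_one_tmul_N _ _).trans (gaugeInr_N (innerAd ω n))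

theorem braidedSnocEquiv_one_tmul_H (hω : ω ≠ 0) :
    braidedSnocEquiv hω n (1 ⊗ₜ Uq.H ω) = inr (Uq.H ω) :=
  rescaledGaugeEquiv_one_tmul_H _ _

theorem braidedSnocEquiv_one_tmul_K (hω : ω ≠ 0) :
    braidedSnocEquiv hω n (1 ⊗ₜ (Uq.K ω : Uq ω)) = inr (Uq.K ω : Uq ω) :=
  rescaledGaugeEquiv_one_tmul_K _ _

theorem inr_brH_mul_braidedSnocEquiv_N_sub (hω : ω ≠ 0) :
    inr (Uq.brH ω) * (braidedSnocEquiv hω n (1 ⊗ₜ Uq.N ω) - inr (Uq.N ω))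
      = braidedSnocEquiv hω n (1 ⊗ₜ Uq.Ad ω) * braidedSnocEquiv hω n (1 ⊗ₜ Uq.A ω)
        - inr (Uq.Ad ω) * inr (Uq.A ω) :=
  inr_brH_mul_rescaledGaugeEquiv_N_sub _ _

theorem X_castSucc (i : Fin n) : X ω i.castSucc = inl (X ω i) := by
  rw [X, X, place_castSucc, map_mul]
  congr 1
  exact expH_eq_inl (by simp) (if_neg (Fin.le_last _).not_gt)

theorem X_last (hω : ω ≠ 0) : X ω (Fin.last n) = braidedSnocEquiv hω n (1 ⊗ₜ Uq.A ω) := by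
  rw [braidedSnocEquiv_one_tmul_A]
  rw [X, place_last]
  congr 1
  exact expH_eq_inl (fun i => if_pos (Fin.castSucc_lt_last i)) (if_neg (lt_irrefl _))

theorem Xd_castSucc (i : Fin n) : Xd ω i.castSucc = inl (Xd ω i) := by
  rw [Xd, Xd, map_sub, map_smul, map_mul, map_mul, map_mul, map_sum, sum_filter_lt_castSucc,
    place_castSucc, place_castSucc, expH_single_castSucc]
  congr 3
  · exact expH_eq_inl (by simp) (if_neg (Fin.le_last _).not_gt)
  · refine Finset.sum_congr rfl fun j _ => ?_
    rw [map_mul, map_mul, map_mul, place_castSucc, expH_single_castSucc]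
    congr 3
    · exact expH_eq_inl (by simp) (if_neg (Fin.le_last _).not_gt)
    · exact expH_eq_inl (by simp) (if_neg fun h => (Fin.le_last _).not_gt h.2)

theorem expH_two_mul_innerAd : expH (fun _ => 2) * innerAd ω n
    = ∑ j, expH (fun k => if k < j then 2 else 0) * expH (Pi.single j 1) *
        expH (fun k => if j < k then -2 else 0) * place j (Uq.Ad ω) := by
  rw [innerAd, Finset.mul_sum]
  refine Finset.sum_congr rfl fun j _ => ?_
  rw [← mul_assoc, ← mul_assoc]
  congr 1
  simp only [← expH_add]
  congr 1
  ext k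
  rcases lt_trichotomy k j with h | rfl | h
  · simp [h, h.not_gt, h.ne]
  · simp
  · simp [h, h.not_gt, h.ne']

theorem Xd_last (hω : ω ≠ 0) : Xd ω (Fin.last n) = braidedSnocEquiv hω n (1 ⊗ₜ Uq.Ad ω) := by
  rw [braidedSnocEquiv_one_tmul_Ad]
  have hs : ∑ j ∈ Finset.univ.filter (· < Fin.last n),
      expH (fun k => if k < j then 2 else 0) * expH (Pi.single j 1) *
        expH (fun k => if j < k ∧ k < Fin.last n then -2 else 0) * place j (Uq.Ad ω)
      = inl (expH (fun _ => 2) * innerAd ω n) := by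
    rw [sum_filter_lt_last, expH_two_mul_innerAd, map_sum]
    refine Finset.sum_congr rfl fun j _ => ?_
    rw [map_mul, map_mul, map_mul, place_castSucc, expH_single_castSucc]
    congr 3
    · exact expH_eq_inl (by simp) (if_neg (Fin.le_last _).not_gt)
    · exact expH_eq_inl (by simp [Fin.castSucc_lt_last]) (if_neg fun h => lt_irrefl _ h.2)
  rw [Xd, hs, place_last, place_last, expH_single_last, Uq.K_zpow_neg_one, ← map_mul, Uq.brH_comm,
    ← (commute_inl_inr _ Uq.Kinv_mul_brH_comm).eq, map_mul inl, mul_sub, mul_smul_comm, mul_assoc]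
  congr 2
  exact expH_eq_inl (fun i => if_pos (Fin.castSucc_lt_last i)) (if_neg (lt_irrefl _))

theorem M_castSucc (i : Fin n) : M ω i.castSucc = inl (M ω i) := by
  rw [M, M, map_sub, map_smul, map_mul, map_sum, sum_filter_lt_castSucc, place_castSucc,
    place_castSucc, expH_single_castSucc]
  congr 3
  refine Finset.sum_congr rfl fun j _ => ?_
  rw [map_mul, map_mul, map_mul, place_castSucc, expH_single_castSucc]
  congr 3
  exact expH_eq_inl (by simp) (if_neg fun h => (Fin.le_last _).not_gt h.2)

theorem M_last (hω : ω ≠ 0) : M ω (Fin.last n) = braidedSnocEquiv hω n (1 ⊗ₜ Uq.N ω) := by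
  rw [braidedSnocEquiv_one_tmul_N]
  have hs : ∑ j ∈ Finset.univ.filter (· < Fin.last n), expH (Pi.single j (-1)) *
        expH (fun k => if j < k ∧ k < Fin.last n then -4 else 0) * place j (Uq.Ad ω)
          * place (Fin.last n) (Uq.A ω)
      = inl (innerAd ω n) * inr (Uq.A ω) := by
    rw [sum_filter_lt_last, innerAd, map_sum, Finset.sum_mul]
    refine Finset.sum_congr rfl fun j _ => ?_
    rw [map_mul, map_mul, place_castSucc, place_last, expH_single_castSucc]
    congr 3
    exact expH_eq_inl (by simp [Fin.castSucc_lt_last]) (if_neg fun h => lt_irrefl _ h.2)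
  rw [M, hs, place_last, expH_single_last, Uq.K_zpow_neg_one, ← mul_assoc,
    ← (commute_inl_inr _ Uq.gen_Kinv_comm).eq, mul_assoc, ← map_mul]

theorem brH_mul_M_sub (hω : ω ≠ 0) (i : Fin n) :
    place i (Uq.brH ω) * (M ω i - place i (Uq.N ω))
      = Xd ω i * X ω i - place i (Uq.Ad ω) * place i (Uq.A ω) := by
  induction n with
  | zero => exact i.elim0
  | succ n ih =>
    induction i using Fin.lastCases with
    | last =>
      rw [M_last hω, Xd_last hω, X_last hω]
      simp only [place_last]
      exact inr_brH_mul_braidedSnocEquiv_N_sub hω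
    | cast i =>
      simp only [place_castSucc, M_castSucc, Xd_castSucc, X_castSucc, ← map_mul, ← map_sub, ih]

/-- The isomorphism from the braided to the ordinary tensor power. -/
def toPiTensor (hω : ω ≠ 0) : (n : ℕ) → BUqTensor ω n ≃ₐ[ℂ] (⨂[ℂ] _ : Fin n, Uq ω)
  | 0 => emptyPiTensorEquiv ℂ fun _ => Uq ω
  | n + 1 => (braidedSnocEquiv hω n).symm.trans
      ((Algebra.TensorProduct.congr (toPiTensor hω n) AlgEquiv.refl).trans
        (snocAlgEquiv ℂ (Uq ω) n))

theorem toPiTensor_braidedSnocEquiv_tmul (hω : ω ≠ 0) (c : BUqTensor ω n) (x : Uq ω) :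
    toPiTensor hω (n + 1) (braidedSnocEquiv hω n (c ⊗ₜ x))
      = snocAlgEquiv ℂ (Uq ω) n (toPiTensor hω n c ⊗ₜ x) := by
  rw [toPiTensor, AlgEquiv.trans_apply, AlgEquiv.symm_apply_apply]
  rfl

theorem toPiTensor_inl_of_eq (hω : ω ≠ 0) {c : BUqTensor ω n} {i : Fin n} {x : Uq ω}
    (h : toPiTensor hω n c = PiTensorProduct.singleAlgHom i x) :
    toPiTensor hω (n + 1) (inl c) = PiTensorProduct.singleAlgHom i.castSucc x := by
  rw [← braidedSnocEquiv_tmul_one hω, toPiTensor_braidedSnocEquiv_tmul, h,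
    snocAlgEquiv_singleAlgHom_tmul_one]

theorem toPiTensor_braidedSnocEquiv_one_tmul (hω : ω ≠ 0) (x : Uq ω) :
    toPiTensor hω (n + 1) (braidedSnocEquiv hω n (1 ⊗ₜ x))
      = PiTensorProduct.singleAlgHom (Fin.last n) x := by
  rw [toPiTensor_braidedSnocEquiv_tmul, map_one, snocAlgEquiv_one_tmul]

theorem toPiTensor_generators (hω : ω ≠ 0) (i : Fin n) :
    toPiTensor hω n (X ω i) = PiTensorProduct.singleAlgHom i (Uq.A ω) ∧
    toPiTensor hω n (Xd ω i) = PiTensorProduct.singleAlgHom i (Uq.Ad ω) ∧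
    toPiTensor hω n (place i (Uq.H ω)) = PiTensorProduct.singleAlgHom i (Uq.H ω) ∧
    toPiTensor hω n (place i (Uq.K ω : Uq ω)) = PiTensorProduct.singleAlgHom i (Uq.K ω : Uq ω) ∧
    toPiTensor hω n (M ω i) = PiTensorProduct.singleAlgHom i (Uq.N ω) := by
  induction n with
  | zero => exact i.elim0
  | succ n ih =>
    induction i using Fin.lastCases with
    | last =>
      rw [M_last hω, Xd_last hω, X_last hω, place_last, place_last]
      rw [← braidedSnocEquiv_one_tmul_H hω, ← braidedSnocEquiv_one_tmul_K hω]
      exact ⟨toPiTensor_braidedSnocEquiv_one_tmul hω _, toPiTensor_braidedSnocEquiv_one_tmul hω _,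
        toPiTensor_braidedSnocEquiv_one_tmul hω _, toPiTensor_braidedSnocEquiv_one_tmul hω _,
        toPiTensor_braidedSnocEquiv_one_tmul hω _⟩
    | cast i =>
      obtain ⟨h₁, h₂, h₃, h₄, h₅⟩ := ih i
      rw [M_castSucc, Xd_castSucc, X_castSucc, place_castSucc, place_castSucc]
      exact ⟨toPiTensor_inl_of_eq hω h₁, toPiTensor_inl_of_eq hω h₂, toPiTensor_inl_of_eq hω h₃,
        toPiTensor_inl_of_eq hω h₄, toPiTensor_inl_of_eq hω h₅⟩

end BUqTensor

end BraidedHeisenberg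

end

open BraidedHeisenberg in
theorem theorem5p1 (ω : ℂ) (hω : ω ≠ 0) (n : ℕ) :
    (∀ i : Fin n,
      BUqTensor.place i (Uq.brH ω) * (BUqTensor.M ω i - BUqTensor.place i (Uq.N ω))
        = BUqTensor.Xd ω i * BUqTensor.X ω i
          - BUqTensor.place i (Uq.Ad ω) * BUqTensor.place i (Uq.A ω)) ∧
    ∃! φ : BUqTensor ω n ≃ₐ[ℂ] (⨂[ℂ] _ : Fin n, Uq ω),
      ∀ i : Fin n,
        φ (BUqTensor.X ω i) = PiTensorProduct.singleAlgHom i (Uq.A ω) ∧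
        φ (BUqTensor.Xd ω i) = PiTensorProduct.singleAlgHom i (Uq.Ad ω) ∧
        φ (BUqTensor.place i (Uq.H ω)) = PiTensorProduct.singleAlgHom i (Uq.H ω) ∧
        φ (BUqTensor.place i (Uq.K ω : Uq ω)) =
          PiTensorProduct.singleAlgHom i (Uq.K ω : Uq ω) ∧
        φ (BUqTensor.M ω i) = PiTensorProduct.singleAlgHom i (Uq.N ω) := by
  refine ⟨BUqTensor.brH_mul_M_sub hω, BUqTensor.toPiTensor hω n, BUqTensor.toPiTensor_generators hω,
    fun φ hφ => Uq.piTensor_algEquiv_ext fun i x hx => ?_⟩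
  suffices h : ∃ u, φ u = PiTensorProduct.singleAlgHom i x ∧
      BUqTensor.toPiTensor hω n u = PiTensorProduct.singleAlgHom i x by
    obtain ⟨u, hφu, hu⟩ := h
    exact (φ.symm_apply_eq.2 hφu.symm).trans ((AlgEquiv.symm_apply_eq _).2 hu.symm).symm
  obtain ⟨hA, hAd, hH, hK, hN⟩ := hφ i
  obtain ⟨hA', hAd', hH', hK', hN'⟩ := BUqTensor.toPiTensor_generators hω i
  rcases hx with rfl | rfl | rfl | rfl | rfl
  exacts [⟨_, hA, hA'⟩, ⟨_, hAd, hAd'⟩, ⟨_, hN, hN'⟩, ⟨_, hH, hH'⟩, ⟨_, hK, hK'⟩]
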